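/- **Setting.** There are $n\ge1$ agents $i\in[n]=\{1,\dots,n\}$ and times $t\in\mathbb N_+$. All norms are Euclidean (spectral for matrices), and $[\cdot]_+$ is the componentwise positive part, i.e. the projection onto the nonnegative orthant. Let $R,F_1,F_2>0$, $w\in(0,1)$, an integer $B\ge1$, $m_1,\dots,m_n\in\mathbb N$, $\kappa\in(0,1)$ and $\theta>0$ be given. *Problem.* $\mathbb X\subseteq\mathbb R^p$ is closed and convex with $\|x\|\le R$ on $\mathbb X$. The functions $f_{i,t}:\mathbb X\to\mathbb R$ and (componentwise) $g_{i,t}:\mathbb X\to\mathbb R^{m_i}$ are convex, with $|f_{i,t}(x)-f_{i,t}(y)|\le F_1$ and $\|g_{i,t}(x)\|\le F_1$ for $x,y\in\mathbb X$. At every $x\in\mathbb X$ there are a subgradient $\partial f_{i,t}(x)\in\mathbb R^p$ of $f_{i,t}$ on $\mathbb X$ and a $p\times m_i$ matrix $\partial g_{i,t}(x)$, whose columns are subgradients on $\mathbb X$ of the components of $g_{i,t}$, both of norm at most $F_2$. Put $f_t=\frac1n\sum_j f_{j,t}$ and $g_t=\mathrm{col}(g_{1,t},\dots,g_{n,t})$.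 *Network.* $\mathcal G_t=([n],\mathcal E_t)$ are directed graphs and $W_t\in\mathbb R^{n\times n}$ are doubly stochastic matrices with $[W_t]_{ij}>0$ if $(j,i)\in\mathcal E_t$ or $i=j$, $[W_t]_{ij}=0$ otherwise, and $[W_t]_{ij}\ge w$ whenever $[W_t]_{ij}>0$. For every $t\in\mathbb N_+$ the graph $([n],\bigcup_{l=0}^{B-1}\mathcal E_{t+l})$ is strongly connected. *Algorithm.* Let $\tau_t=t^{-\theta}$, $\Psi_t=\sum_{s=1}^t\tau_s$, $\alpha_t=\sqrt{\Psi_t/t}$, $\beta_t=t^{-\kappa}$, $\gamma_t=t^{-(1-\kappa)}$. Start from any $x_{i,1}\in\mathbb X$, $\hat x_{i,1}=x_{i,1}$, $q_{i,1}=0$. For $t\ge1$ each agent observes $[g_{i,t}(x_{i,t})]_+$, a subgradient $u_{i,t}$ of $f_{i,t}$ at $x_{i,t}$, and a $p\times m_i$ matrix $D_{i,t}$ whose columns are subgradients at $x_{i,t}$ of the components of $[g_{i,t}]_+$, with $\|u_{i,t}\|,\|D_{i,t}\|\le F_2$, and sets $$z_{i,t+1}=\sum_{j=1}^n[W_t]_{ij}\hat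 x_{j,t},\qquad \omega_{i,t+1}=u_{i,t}+D_{i,t}q_{i,t},\qquad x_{i,t+1}=\mathcal P_{\mathbb X}(z_{i,t+1}-\alpha_{t+1}\omega_{i,t+1}),$$ $$q_{i,t+1}=\Big[(1-\beta_{t+1}\gamma_{t+1})q_{i,t}+\gamma_{t+1}\big([g_{i,t}(x_{i,t})]_++D_{i,t}^{T}(x_{i,t+1}-x_{i,t})\big)\Big]_+,$$ where $\mathcal P_{\mathbb X}$ is the Euclidean projection onto $\mathbb X$; and $\hat x_{i,t+1}=x_{i,t+1}$ if $\|x_{i,t+1}-\hat x_{i,t}\|\ge\tau_{t+1}$, $\hat x_{i,t+1}=\hat x_{i,t}$ otherwise. *Performance measures.* For $T\in\mathbb N_+$ let $\mathcal X_T$ be the set of sequences $y_{[T]}=(y_1,\dots,y_T)$ in $\mathbb X$ with $g_t(y_t)\le0$ for all $t\le T$, and put $$\mathrm{Reg}_T(y)=\frac1n\sum_{i=1}^n\sum_{t=1}^Tf_t(x_{i,t})-\sum_{t=1}^Tf_t(y_t),\quad \mathrm{CCV}_T=\frac1n\sum_{i=1}^n\sum_{t=1}^T\big\|[g_t(x_{i,t})]_+\big\|,\quad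 P_T=\sum_{t=1}^{T-1}\|y_{t+1}-y_t\|.$$ **Claim.** There is a constant $C>0$, depending only on $n,(m_i),R,F_1,F_2,w,B,\kappa,\theta$, such that for all data as above, all sequences generated by the algorithm and all $T\in\mathbb N_+$ the following holds. (a) For every $y_{[T]}\in\mathcal X_T$, $$\mathrm{Reg}_T(y)\le\begin{cases}C\big(T^{\max\{\kappa,1-\theta/2\}}+T^{\theta/2}P_T\big)&\text{if }0<\theta<1,\\ C\big(T^{\kappa}+\sqrt{T\log T}+\sqrt{T/\log T}\,P_T\big)&\text{if }\theta=1,\\ C\big(T^{\max\{\kappa,1/2\}}+T^{1/2}P_T\big)&\text{if }\theta>1\end{cases}$$ (for $T=1$ one has $P_T=0$, and the terms with $P_T$ are read as $0$). (b) If some constant sequence $(x,\dots,x)$ lies in $\mathcal X_T$, then $$\mathrm{CCV}_T\le\begin{cases}C\,T^{\max\{1-\kappa/2,\,1-\theta/4\}}&\text{if }0<\theta<1,\\ C\big(T^{1-\kappa/2}+(T^3\log T)^{1/4}\big)&\text{if }\theta=1,\\ C\,T^{\max\{1-\kappa/2,\,3/4\}}&\text{if }\theta>1.\end{cases}$$ 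-/

import Mathlib

namespace EventTriggered

noncomputable section

/-- `ℝᵖ` with the Euclidean norm. -/
abbrev Vec (p : ℕ) : Type := EuclideanSpace ℝ (Fin p)

/-- `x` is the Euclidean projection of `v` onto `K`: a point of `K` at minimal distance from `v`. -/
def IsProj {E : Type*} [NormedAddCommGroup E] (K : Set E) (v x : E) : Prop :=
  x ∈ K ∧ ∀ y ∈ K, ‖v - x‖ ≤ ‖v - y‖

/-- `[v]₊`, the componentwise positive part. -/
def posVec {ι : Type*} (v : EuclideanSpace ℝ ι) : EuclideanSpace ℝ ι :=
  WithLp.toLp 2 (fun k => max (v k) 0)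

/-- `[v]₊` is the projection of `v` onto the nonnegative orthant. -/
theorem isProj_posVec {ι : Type*} [Fintype ι] (v : EuclideanSpace ℝ ι) :
    IsProj {u : EuclideanSpace ℝ ι | ∀ k, 0 ≤ u k} v (posVec v) := by
  refine ⟨fun k => le_max_right _ _, fun y hy => ?_⟩
  rw [EuclideanSpace.norm_eq, EuclideanSpace.norm_eq]
  refine Real.sqrt_le_sqrt (Finset.sum_le_sum fun k _ => ?_)
  have h0 : 0 ≤ y k := hy k
  simp only [PiLp.sub_apply, posVec, Real.norm_eq_abs, sq_abs]
  rcases le_total (v k) 0 with h | h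
  · rw [max_eq_right h]; nlinarith
  · rw [max_eq_left h]; nlinarith [sq_nonneg (v k - y k)]

/-- `v` is a subgradient at `x` of the real-valued function `f` on `X`. -/
def IsSubgradientOn {p : ℕ} (X : Set (Vec p)) (f : Vec p → ℝ) (x v : Vec p) : Prop :=
  ∀ y ∈ X, f x + inner ℝ v (y - x) ≤ f y

/-- `D : ℝᵖ → ℝᵏ` is the transpose `(∂g(x))ᵀ` of a `p × k` matrix `∂g(x)` whose `j`-th column is
a subgradient at `x` of the `j`-th component of `g` on `X`. The matrix itself acts as
`ContinuousLinearMap.adjoint D`, and `‖D‖` is its spectral norm. -/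
def IsVecSubgradientOn {p k : ℕ} (X : Set (Vec p)) (g : Vec p → Vec k) (x : Vec p)
    (D : Vec p →L[ℝ] Vec k) : Prop :=
  ∀ j : Fin k, ∀ y ∈ X, g x j + D (y - x) j ≤ g y j

/-- Assumptions on the decision set, the local losses `f i t` and the local constraint functions
`g i t` (`t ≥ 1`). Only the values on `X` matter. -/
structure ConvexProblem {n p : ℕ} {m : Fin n → ℕ} (X : Set (Vec p)) (f : Fin n → ℕ → Vec p → ℝ)
    (g : (i : Fin n) → ℕ → Vec p → Vec (m i)) (R F₁ F₂ : ℝ) : Prop where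
  convex : Convex ℝ X
  closed : IsClosed X
  bounded : ∀ x ∈ X, ‖x‖ ≤ R
  convex_loss : ∀ i, ∀ t ≥ 1, ConvexOn ℝ X (f i t)
  convex_constraint : ∀ i, ∀ t ≥ 1, ∀ k, ConvexOn ℝ X (fun x => g i t x k)
  loss_variation : ∀ i, ∀ t ≥ 1, ∀ x ∈ X, ∀ y ∈ X, |f i t x - f i t y| ≤ F₁
  constraint_bound : ∀ i, ∀ t ≥ 1, ∀ x ∈ X, ‖g i t x‖ ≤ F₁
  loss_subgradient : ∀ i, ∀ t ≥ 1, ∀ x ∈ X, ∃ v, IsSubgradientOn X (f i t) x v ∧ ‖v‖ ≤ F₂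
  constraint_subgradient : ∀ i, ∀ t ≥ 1, ∀ x ∈ X,
    ∃ D, IsVecSubgradientOn X (g i t) x D ∧ ‖D‖ ≤ F₂

/-- Assumptions on the time-varying directed graphs `G t` (`(G t).Adj j i` says that `(j, i)` is an
edge, so that `i` receives from `j`) and on the mixing matrices `W t`, for `t ≥ 1`. -/
structure MixingNetwork {n : ℕ} (G : ℕ → Digraph (Fin n)) (W : ℕ → Matrix (Fin n) (Fin n) ℝ)
    (w : ℝ) (B : ℕ) : Prop where
  weight_pos : ∀ t ≥ 1, ∀ i j, ((G t).Adj j i ∨ i = j) → 0 < W t i j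
  weight_zero : ∀ t ≥ 1, ∀ i j, ¬ ((G t).Adj j i ∨ i = j) → W t i j = 0
  weight_lower : ∀ t ≥ 1, ∀ i j, 0 < W t i j → w ≤ W t i j
  row_sum : ∀ t ≥ 1, ∀ i, ∑ j, W t i j = 1
  col_sum : ∀ t ≥ 1, ∀ j, ∑ i, W t i j = 1
  /-- the union of any `B` consecutive graphs is strongly connected -/
  jointly_connected : ∀ t ≥ 1, ∀ i j,
    Relation.ReflTransGen (fun a b => ∃ l < B, (G (t + l)).Adj a b) i j

/-- The sequences occurring in the algorithm, indexed by agent and time `t ≥ 1` (index `0` is not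
used): local decisions `x`, last broadcast decisions `xhat`, consensus variables `z`, update
directions `ω`, dual variables `q`, the observed subgradients `u i t` of `f i t`, and the
transposes `D i t` of the observed subgradients of `[g i t]₊`. -/
structure Trajectory (n p : ℕ) (m : Fin n → ℕ) where
  x : Fin n → ℕ → Vec p
  xhat : Fin n → ℕ → Vec p
  z : Fin n → ℕ → Vec p
  ω : Fin n → ℕ → Vec p
  q : (i : Fin n) → ℕ → Vec (m i)
  u : Fin n → ℕ → Vec p
  D : (i : Fin n) → ℕ → (Vec p →L[ℝ] Vec (m i))

/-- `s` is generated by the distributed event-triggered online primal-dual algorithm with step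
sizes `α`, `β`, regularization `γ` and triggering thresholds `τ`. The observed subgradients are
arbitrary subgradients, relative to `X`, that obey the bound `F₂`. -/
structure Generated {n p : ℕ} {m : Fin n → ℕ} (X : Set (Vec p)) (f : Fin n → ℕ → Vec p → ℝ)
    (g : (i : Fin n) → ℕ → Vec p → Vec (m i)) (F₂ : ℝ) (W : ℕ → Matrix (Fin n) (Fin n) ℝ)
    (α β γ τ : ℕ → ℝ) (s : Trajectory n p m) : Prop where
  init_x : ∀ i, s.x i 1 ∈ X
  init_xhat : ∀ i, s.xhat i 1 = s.x i 1
  init_q : ∀ i, s.q i 1 = 0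
  observe_loss : ∀ i, ∀ t ≥ 1, IsSubgradientOn X (f i t) (s.x i t) (s.u i t)
  observe_loss_bound : ∀ i, ∀ t ≥ 1, ‖s.u i t‖ ≤ F₂
  observe_constraint : ∀ i, ∀ t ≥ 1,
    IsVecSubgradientOn X (fun x => posVec (g i t x)) (s.x i t) (s.D i t)
  observe_constraint_bound : ∀ i, ∀ t ≥ 1, ‖s.D i t‖ ≤ F₂
  consensus : ∀ i, ∀ t ≥ 1, s.z i (t + 1) = ∑ j, W t i j • s.xhat j t
  direction : ∀ i, ∀ t ≥ 1,
    s.ω i (t + 1) = s.u i t + ContinuousLinearMap.adjoint (s.D i t) (s.q i t)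
  primal : ∀ i, ∀ t ≥ 1, IsProj X (s.z i (t + 1) - α (t + 1) • s.ω i (t + 1)) (s.x i (t + 1))
  dual : ∀ i, ∀ t ≥ 1, s.q i (t + 1) =
    posVec ((1 - β (t + 1) * γ (t + 1)) • s.q i t +
      γ (t + 1) • (posVec (g i t (s.x i t)) + s.D i t (s.x i (t + 1) - s.x i t)))
  trigger : ∀ i, ∀ t ≥ 1, τ (t + 1) ≤ ‖s.x i (t + 1) - s.xhat i t‖ →
    s.xhat i (t + 1) = s.x i (t + 1)
  no_trigger : ∀ i, ∀ t ≥ 1, ‖s.x i (t + 1) - s.xhat i t‖ < τ (t + 1) →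
    s.xhat i (t + 1) = s.xhat i t

/-- Global loss `f_t = (1/n) ∑ⱼ f_{j,t}`. -/
def globalLoss {n p : ℕ} (f : Fin n → ℕ → Vec p → ℝ) (t : ℕ) (x : Vec p) : ℝ :=
  (1 / (n : ℝ)) * ∑ j, f j t x

/-- Global constraint `g_t = col(g_{1,t}, …, g_{n,t})`, a vector with `∑ⱼ mⱼ` components. -/
def globalConstraint {n p : ℕ} {m : Fin n → ℕ} (g : (i : Fin n) → ℕ → Vec p → Vec (m i))
    (t : ℕ) (x : Vec p) : EuclideanSpace ℝ ((i : Fin n) × Fin (m i)) :=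
  WithLp.toLp 2 (fun k => g k.1 t x k.2)

/-- Feasible decision sequences over the horizon `T` (only the entries `1, …, T` matter). -/
def feasibleSeqs {n p : ℕ} {m : Fin n → ℕ} (X : Set (Vec p))
    (g : (i : Fin n) → ℕ → Vec p → Vec (m i)) (T : ℕ) : Set (ℕ → Vec p) :=
  {y | ∀ t ∈ Finset.Icc 1 T, y t ∈ X ∧ ∀ k, globalConstraint g t (y t) k ≤ 0}

/-- Decisions whose constant sequence is feasible over the horizon `T`. -/
def feasibleStatic {n p : ℕ} {m : Fin n → ℕ} (X : Set (Vec p))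
    (g : (i : Fin n) → ℕ → Vec p → Vec (m i)) (T : ℕ) : Set (Vec p) :=
  {y | (fun _ => y) ∈ feasibleSeqs X g T}

/-- Network regret of the decisions `x` against the comparator sequence `y`. -/
def netReg {n p : ℕ} (f : Fin n → ℕ → Vec p → ℝ) (x : Fin n → ℕ → Vec p) (y : ℕ → Vec p)
    (T : ℕ) : ℝ :=
  (1 / (n : ℝ)) * ∑ i, ∑ t ∈ Finset.Icc 1 T, globalLoss f t (x i t) -
    ∑ t ∈ Finset.Icc 1 T, globalLoss f t (y t)

/-- Network cumulative constraint violation of the decisions `x`. -/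
def netCCV {n p : ℕ} {m : Fin n → ℕ} (g : (i : Fin n) → ℕ → Vec p → Vec (m i))
    (x : Fin n → ℕ → Vec p) (T : ℕ) : ℝ :=
  (1 / (n : ℝ)) * ∑ i, ∑ t ∈ Finset.Icc 1 T, ‖posVec (globalConstraint g t (x i t))‖

/-- Path length `P_T = ∑_{t=1}^{T-1} ‖y_{t+1} - y_t‖`. -/
def pathLength {p : ℕ} (y : ℕ → Vec p) (T : ℕ) : ℝ :=
  ∑ t ∈ Finset.Ico 1 T, ‖y (t + 1) - y t‖

/-- Triggering threshold `τ_t = 1 / t^θ`. -/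
def tauSeq (θ : ℝ) (t : ℕ) : ℝ := 1 / (t : ℝ) ^ θ

/-- `Ψ_t = ∑_{s=1}^t τ_s`. -/
def psiSeq (τ : ℕ → ℝ) (t : ℕ) : ℝ := ∑ s ∈ Finset.Icc 1 t, τ s

/-- Primal step size `α_t = √(Ψ_t / t)`. -/
def alphaSeq (τ : ℕ → ℝ) (t : ℕ) : ℝ := √(psiSeq τ t / (t : ℝ))

/-- Dual step size `β_t = 1 / t^κ`. -/
def betaSeq (κ : ℝ) (t : ℕ) : ℝ := 1 / (t : ℝ) ^ κ

/-- Regularization parameter `γ_t = 1 / t^(1-κ)`. -/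
def gammaSeq (κ : ℝ) (t : ℕ) : ℝ := 1 / (t : ℝ) ^ (1 - κ)

end

end EventTriggered

namespace EventTriggered

open Finset

/-! The proof is a primal-dual energy estimate with a free multiplier `r ≥ 0`. The primal step is
tested against a feasible comparator `y`, the dual recursion against the constant vector `r • ones`.
Since `q ≥ 0` and `y` is feasible, the pairing of `q` with the linearized constraint is controlled
by the primal step (`Generated.agent_step_le`). The dual recursion is projected gradient ascent on a
regularized linear function (`sum_inner_dual_le`). Adding the two cancels `q` and bounds regret plus
`r` times violation.

What remains is mainly the movement `∑ ‖x (t+1) - x t‖`, with a weight of order `1 + r`. It is at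
most the sum `E` of the residuals `‖x - z‖`, plus multiples of `Ψ_T` and of the total disagreement.
A product of `n * B` mixing matrices has all entries at least `w ^ (n * B)`, hence contracts
zero-sum families, so the total disagreement is `O(1 + E + Ψ_T)` (`sum_disagreement_le`). Finally
`E` is absorbed, by Young's inequality, into the negative squares left by the projection, at the
price `(1 + r)² ∑ α`.

Stale broadcasts also cost about `Ψ_T / α_T` in the telescoping sum. The choice `α_t = √(Ψ_t / t)`
makes this and `∑ α` both of order `√(T Ψ_T)`. Up to constants, `exists_power_bound` then says:
regret + `r` · violation ≤ `T^κ + √(T Ψ_T) + √(T / Ψ_T) P_T + r² (T^(1-κ) + √(T Ψ_T))`.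

Taking `r = 0` gives (a). For (b) the comparator is static and regret is at least `-O(T)`, so `r` ·
violation is `O(T + r² A)` with `A = T^(1-κ) + √(T Ψ_T)`; the choice `r² A = T` gives `O(√(T A))`.
The three cases in `θ` are the growth rates of `Ψ_T`: a power, a logarithm, a constant. -/

/-- The product `W (s + k - 1) * ⋯ * W (s + 1) * W s`. -/
def mixProd {n : ℕ} (W : ℕ → Matrix (Fin n) (Fin n) ℝ) (s : ℕ) : ℕ → Matrix (Fin n) (Fin n) ℝ
  | 0 => 1
  | k + 1 => W (s + k) * mixProd W s k

/-! ### Mixing matrices: positivity of long products and contraction of disagreement -/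

section Network

variable {n : ℕ} {G : ℕ → Digraph (Fin n)} {W : ℕ → Matrix (Fin n) (Fin n) ℝ} {w : ℝ} {B : ℕ}

theorem MixingNetwork.nonneg (h : MixingNetwork G W w B) {t : ℕ} (ht : 1 ≤ t) (i j : Fin n) :
    0 ≤ W t i j := by
  by_cases hc : (G t).Adj j i ∨ i = j
  · exact (h.weight_pos t ht i j hc).le
  · exact (h.weight_zero t ht i j hc).ge

theorem mixProd_nonneg (h : MixingNetwork G W w B) {s : ℕ} (hs : 1 ≤ s) (k : ℕ) (i j : Fin n) :
    0 ≤ mixProd W s k i j := by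
  induction k generalizing i with
  | zero => simp only [mixProd, Matrix.one_apply]; split_ifs <;> norm_num
  | succ k ih =>
    rw [mixProd, Matrix.mul_apply]
    exact sum_nonneg fun a _ => mul_nonneg (h.nonneg (by omega) i a) (ih a)

theorem mixProd_row_sum (h : MixingNetwork G W w B) {s : ℕ} (hs : 1 ≤ s) (k : ℕ) (i : Fin n) :
    ∑ j, mixProd W s k i j = 1 := by
  induction k generalizing i with
  | zero => simp [mixProd, Matrix.one_apply]
  | succ k ih =>
    simp only [mixProd, Matrix.mul_apply]
    rw [sum_comm]
    simp only [← mul_sum, ih, mul_one]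
    exact h.row_sum _ (by omega) i

theorem mixProd_col_sum (h : MixingNetwork G W w B) {s : ℕ} (hs : 1 ≤ s) (k : ℕ) (j : Fin n) :
    ∑ i, mixProd W s k i j = 1 := by
  induction k with
  | zero => simp [mixProd, Matrix.one_apply]
  | succ k ih =>
    simp only [mixProd, Matrix.mul_apply]
    rw [sum_comm]
    simp only [← sum_mul, h.col_sum _ (show 1 ≤ s + k by omega), one_mul]
    exact ih

/-- The summand through `a` alone suffices. Allowing `i = a` uses the self-weights: an agent once
reached stays reached. -/
theorem mixProd_step (h : MixingNetwork G W w B) (hw : 0 < w) {s : ℕ} (hs : 1 ≤ s) {k : ℕ}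
    {i a j : Fin n} (ha : w ^ k ≤ mixProd W s k a j) (hi : (G (s + k)).Adj a i ∨ i = a) :
    w ^ (k + 1) ≤ mixProd W s (k + 1) i j := by
  have h1 : w ≤ W (s + k) i a :=
    h.weight_lower _ (by omega) _ _ (h.weight_pos _ (by omega) _ _ hi)
  rw [mixProd, Matrix.mul_apply]
  calc w ^ (k + 1) = w * w ^ k := by ring
    _ ≤ W (s + k) i a * mixProd W s k a j :=
        mul_le_mul h1 ha (pow_nonneg hw.le _) (hw.le.trans h1)
    _ ≤ _ := single_le_sum (f := fun a => W (s + k) i a * mixProd W s k a j)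
        (fun a _ => mul_nonneg (h.nonneg (by omega) i a) (mixProd_nonneg h hs k a j)) (mem_univ a)

theorem mixProd_mono (h : MixingNetwork G W w B) (hw : 0 < w) {s : ℕ} (hs : 1 ≤ s) {k : ℕ}
    (l : ℕ) {i j : Fin n} (ha : w ^ k ≤ mixProd W s k i j) :
    w ^ (k + l) ≤ mixProd W s (k + l) i j := by
  induction l with
  | zero => simpa using ha
  | succ l ih => exact mixProd_step h hw hs ih (Or.inr rfl)

theorem exists_crossing {α : Type*} {r : α → α → Prop} {S : α → Prop} {a b : α}
    (hab : Relation.ReflTransGen r a b) (ha : S a) (hb : ¬ S b) :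
    ∃ c d, r c d ∧ S c ∧ ¬ S d := by
  by_contra! hcon
  refine hb ?_
  clear hb
  induction hab with
  | refl => exact ha
  | tail _ hcd ih => exact hcon _ _ hcd ih

/-- Information from `j` reaches at least one new agent in every block of `B` steps. Joint
connectivity gives, within the block, an edge leaving the set reached so far; self-weights carry the
mass up to that edge and on to the end of the block. -/
theorem card_reached (h : MixingNetwork G W w B) (hw : 0 < w) {s : ℕ} (hs : 1 ≤ s) (j : Fin n)
    (c : ℕ) (hc : c ≤ n) :
    c ≤ (univ.filter fun i => w ^ (c * B) ≤ mixProd W s (c * B) i j).card := by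
  induction c with
  | zero => simp
  | succ c ih =>
    have ih := ih (by omega)
    set S := univ.filter fun i => w ^ (c * B) ≤ mixProd W s (c * B) i j with hS
    set S' := univ.filter fun i => w ^ ((c + 1) * B) ≤ mixProd W s ((c + 1) * B) i j with hS'
    have hsub : S ⊆ S' := by
      intro i hi
      simp only [hS, hS', mem_filter, mem_univ, true_and] at hi ⊢
      rw [add_mul, one_mul]
      exact mixProd_mono h hw hs B hi
    by_cases hall : ∀ i, i ∈ S
    · have : S = univ := eq_univ_iff_forall.2 hall
      have h2 := card_le_card hsub
      rw [this, card_univ, Fintype.card_fin] at h2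
      omega
    · push Not at hall
      obtain ⟨i, hi⟩ := hall
      have hj : j ∈ S := by
        have h0 : w ^ 0 ≤ mixProd W s 0 j j := by simp [mixProd]
        have := mixProd_mono h hw hs (c * B) h0
        simpa [hS] using this
      obtain ⟨a, b, ⟨l, hl, hadj⟩, ha, hb⟩ :=
        exists_crossing (S := fun i => i ∈ S)
          (h.jointly_connected (s + c * B) (by omega) j i) hj hi
      have hb' : b ∈ S' := by
        simp only [hS, hS', mem_filter, mem_univ, true_and] at ha ⊢
        have h1 := mixProd_mono h hw hs l ha
        rw [add_assoc] at hadj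
        have h2 := mixProd_mono h hw hs (B - l - 1) (mixProd_step h hw hs h1 (Or.inl hadj))
        have e : c * B + l + 1 + (B - l - 1) = (c + 1) * B := by rw [add_mul, one_mul]; omega
        rwa [e] at h2
      have : S.card < S'.card := card_lt_card ⟨hsub, fun hcon => hb (hcon hb')⟩
      omega

theorem mixProd_lower (h : MixingNetwork G W w B) (hw : 0 < w) {s : ℕ} (hs : 1 ≤ s)
    (i j : Fin n) : w ^ (n * B) ≤ mixProd W s (n * B) i j := by
  have h1 := card_reached h hw hs j n le_rfl
  have h2 : (univ.filter fun i => w ^ (n * B) ≤ mixProd W s (n * B) i j) = univ := by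
    apply eq_univ_of_card
    rw [Fintype.card_fin]
    exact le_antisymm (card_finset_fin_le _) h1
  have := mem_univ i
  rw [← h2] at this
  exact (mem_filter.1 this).2

variable {E : Type*} [NormedAddCommGroup E] [NormedSpace ℝ E]

/-- A nonnegative matrix whose columns sum to `r` scales `∑ ‖y i‖` by at most `r`. -/
theorem sum_norm_mix_le {P : Matrix (Fin n) (Fin n) ℝ} {r : ℝ} (h0 : ∀ i j, 0 ≤ P i j)
    (hc : ∀ j, ∑ i, P i j = r) (y : Fin n → E) :
    ∑ i, ‖∑ j, P i j • y j‖ ≤ r * ∑ i, ‖y i‖ := by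
  calc ∑ i, ‖∑ j, P i j • y j‖ ≤ ∑ i, ∑ j, P i j * ‖y j‖ := by
        refine sum_le_sum fun i _ => (norm_sum_le _ _).trans (sum_le_sum fun j _ => ?_)
        rw [norm_smul, Real.norm_of_nonneg (h0 i j)]
    _ = r * ∑ i, ‖y i‖ := by
        rw [sum_comm, mul_sum]
        exact sum_congr rfl fun j _ => by rw [← sum_mul, hc]

/-- As the `y i` sum to zero, `η` can be subtracted from every entry without changing the result.
The reduced matrix is still nonnegative, with column sums `1 - n η ≤ 1 - η`. -/
theorem sum_norm_mix_contract (hn : 0 < n) {P : Matrix (Fin n) (Fin n) ℝ} {η : ℝ} (hη : 0 ≤ η)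
    (h0 : ∀ i j, η ≤ P i j) (hc : ∀ j, ∑ i, P i j = 1) {y : Fin n → E} (hy : ∑ i, y i = 0) :
    ∑ i, ‖∑ j, P i j • y j‖ ≤ (1 - η) * ∑ i, ‖y i‖ := by
  have h1 : ∀ i, ∑ j, P i j • y j = ∑ j, (P i j - η) • y j := fun i => by
    simp only [sub_smul, sum_sub_distrib, ← smul_sum, hy, smul_zero, sub_zero]
  simp only [h1]
  refine (sum_norm_mix_le (P := fun i j => P i j - η) (r := 1 - n * η)
    (fun i j => sub_nonneg.2 (h0 i j)) (fun j => ?_) y).trans ?_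
  · simp [sum_sub_distrib, hc]
  · have : (1 : ℝ) ≤ n := by exact_mod_cast hn
    refine mul_le_mul_of_nonneg_right ?_ (sum_nonneg fun i _ => norm_nonneg _)
    nlinarith

/-- Unrolling the recursion: column sums equal to one mean that later mixing never enlarges an
earlier perturbation in the sum of norms. -/
theorem sum_norm_perturbed (h : MixingNetwork G W w B) {y : Fin n → ℕ → E} {δ : ℕ → ℝ}
    (hδ : ∀ t ≥ 1, ∑ i, ‖y i (t + 1) - ∑ j, W t i j • y j t‖ ≤ δ t) {s : ℕ} (hs : 1 ≤ s)
    (k : ℕ) :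
    ∑ i, ‖y i (s + k) - ∑ j, mixProd W s k i j • y j s‖ ≤ ∑ l ∈ range k, δ (s + l) := by
  induction k with
  | zero => simp [mixProd, Matrix.one_apply]
  | succ k ih =>
    rw [sum_range_succ]
    have h1 : ∀ i, y i (s + (k + 1)) - ∑ j, mixProd W s (k + 1) i j • y j s =
        ∑ a, W (s + k) i a • (y a (s + k) - ∑ j, mixProd W s k a j • y j s) +
        (y i (s + k + 1) - ∑ j, W (s + k) i j • y j (s + k)) := fun i => by
      have : ∑ j, mixProd W s (k + 1) i j • y j s =
          ∑ a, W (s + k) i a • ∑ j, mixProd W s k a j • y j s := by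
        simp only [mixProd, Matrix.mul_apply, sum_smul, smul_sum, smul_smul]
        rw [sum_comm]
      simp only [this, smul_sub, sum_sub_distrib]
      rw [← add_assoc]
      abel
    have h2 := sum_norm_mix_le (r := 1) (fun i j => h.nonneg (show 1 ≤ s + k by omega) i j)
      (h.col_sum (s + k) (by omega))
      (fun a => y a (s + k) - ∑ j, mixProd W s k a j • y j s)
    calc _ ≤ ∑ i, (‖∑ a, W (s + k) i a • (y a (s + k) - ∑ j, mixProd W s k a j • y j s)‖ +
          ‖y i (s + k + 1) - ∑ j, W (s + k) i j • y j (s + k)‖) :=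
          sum_le_sum fun i _ => by rw [h1]; exact norm_add_le _ _
      _ ≤ _ := by
          rw [sum_add_distrib]
          have := hδ (s + k) (by omega)
          linarith

/-- Disagreement of a perturbed consensus iteration is summable against its perturbations. -/
theorem sum_disagreement_le (hn : 0 < n) (h : MixingNetwork G W w B) (hw : 0 < w)
    {y : Fin n → ℕ → E} {δ : ℕ → ℝ} {M : ℝ} (hδ0 : ∀ t, 0 ≤ δ t)
    (hδ : ∀ t ≥ 1, ∑ i, ‖y i (t + 1) - ∑ j, W t i j • y j t‖ ≤ δ t)
    (hy : ∀ t ≥ 1, ∑ i, y i t = 0) (hM : ∀ t ≥ 1, ∑ i, ‖y i t‖ ≤ M) (T : ℕ) :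
    w ^ (n * B) * ∑ t ∈ range T, ∑ i, ‖y i (t + 1)‖ ≤
      (n * B : ℕ) * (M + ∑ t ∈ range T, δ (t + 1)) := by
  set L := n * B with hL
  set η := w ^ L with hη
  have hη0 : 0 < η := pow_pos hw _
  have hM0 : 0 ≤ M := le_trans (sum_nonneg fun i _ => norm_nonneg _) (hM 1 le_rfl)
  set a : ℕ → ℝ := fun t => ∑ i, ‖y i (t + 1)‖ with ha
  have ha0 : ∀ t, 0 ≤ a t := fun t => sum_nonneg fun i _ => norm_nonneg _
  have hstep : ∀ t, a (t + L) ≤ (1 - η) * a t + ∑ l ∈ range L, δ (t + 1 + l) := by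
    intro t
    have h1 := sum_norm_perturbed h hδ (s := t + 1) (by omega) L
    have h2 := sum_norm_mix_contract hn hη0.le
      (fun i j => mixProd_lower h hw (s := t + 1) (by omega) i j)
      (mixProd_col_sum h (by omega) L) (hy (t + 1) (by omega))
    calc a (t + L) ≤ ∑ i, (‖∑ j, mixProd W (t + 1) L i j • y j (t + 1)‖ +
          ‖y i (t + 1 + L) - ∑ j, mixProd W (t + 1) L i j • y j (t + 1)‖) := by
          refine sum_le_sum fun i _ => ?_
          have e : t + L + 1 = t + 1 + L := by omega
          rw [e]
          calc _ = ‖∑ j, mixProd W (t + 1) L i j • y j (t + 1) + (y i (t + 1 + L) -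
              ∑ j, mixProd W (t + 1) L i j • y j (t + 1))‖ := by congr 1; abel
            _ ≤ _ := norm_add_le _ _
      _ ≤ _ := by rw [sum_add_distrib]; exact add_le_add h2 h1
  have hδs : 0 ≤ ∑ t ∈ range T, δ (t + 1) := sum_nonneg fun t _ => hδ0 _
  have hη1 : 0 ≤ ∑ t ∈ range T, a t := sum_nonneg fun t _ => ha0 t
  have hone : η ≤ 1 := by
    by_contra! hcon
    have := h.row_sum 1 le_rfl ⟨0, hn⟩
    have h3 : η ≤ mixProd W 1 L ⟨0, hn⟩ ⟨0, hn⟩ := mixProd_lower h hw le_rfl _ _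
    have h4 := mixProd_row_sum h le_rfl L (⟨0, hn⟩ : Fin n)
    have h5 := single_le_sum (f := fun j => mixProd W 1 L ⟨0, hn⟩ j)
      (fun j _ => mixProd_nonneg h le_rfl L _ j) (mem_univ (⟨0, hn⟩ : Fin n))
    linarith
  have hhead : ∀ N ≤ L, ∑ t ∈ range N, a t ≤ L * M := fun N hN => by
    calc ∑ t ∈ range N, a t ≤ ∑ t ∈ range N, M := sum_le_sum fun t _ => hM (t + 1) (by omega)
      _ = N * M := by simp
      _ ≤ L * M := by gcongr
  -- Summing the block contraction shifted by `L` reproduces the whole sum on the right with factor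
  -- `1 - η`; moving it to the left leaves `η` times the sum. The first `L` terms, which no block
  -- precedes, are bounded by `M` each.
  have key : ∑ t ∈ range T, a t ≤ L * M + ((1 - η) * ∑ t ∈ range T, a t +
      L * ∑ t ∈ range T, δ (t + 1)) := by
    rcases le_total T L with hT | hT
    · have := hhead T hT
      have h1 : 0 ≤ (1 - η) * ∑ t ∈ range T, a t := mul_nonneg (by linarith) hη1
      have h2 : 0 ≤ L * ∑ t ∈ range T, δ (t + 1) := by positivity
      linarith
    · obtain ⟨N, rfl⟩ := Nat.exists_eq_add_of_le hT
      refine (sum_range_add a L N).trans_le (add_le_add (hhead L le_rfl) ?_)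
      calc ∑ t ∈ range N, a (L + t) ≤
          ∑ t ∈ range N, ((1 - η) * a t + ∑ l ∈ range L, δ (t + 1 + l)) :=
            sum_le_sum fun t _ => by rw [add_comm]; exact hstep t
        _ = (1 - η) * ∑ t ∈ range N, a t + ∑ l ∈ range L, ∑ t ∈ range N, δ (t + 1 + l) := by
            rw [sum_add_distrib, mul_sum, sum_comm (s := range N)]
        _ ≤ _ := by
            refine add_le_add (mul_le_mul_of_nonneg_left ?_ (by linarith)) ?_
            · exact sum_le_sum_of_subset_of_nonneg (range_mono (by omega)) fun t _ _ => ha0 t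
            · calc _ ≤ ∑ l ∈ range L, ∑ t ∈ range (L + N), δ (t + 1) := by
                    refine sum_le_sum fun l hl => ?_
                    rw [mem_range] at hl
                    have h6 : ∑ t ∈ range N, δ (t + 1 + l) = ∑ t ∈ (range N).map
                        (addRightEmbedding l), δ (t + 1) := by
                      rw [sum_map]
                      refine sum_congr rfl fun t _ => ?_
                      simp only [addRightEmbedding_apply]
                      congr 1; omega
                    rw [h6]
                    refine sum_le_sum_of_subset_of_nonneg ?_ fun t _ _ => hδ0 _
                    intro t ht
                    simp only [mem_map, mem_range, addRightEmbedding_apply] at ht ⊢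
                    obtain ⟨c, hc, rfl⟩ := ht
                    omega
                _ = _ := by simp
  nlinarith [key]

end Network

/-! ### Positive parts and the all-ones vector -/

section PosVec

variable {ι : Type*} [Fintype ι]

theorem norm_le_norm_of_abs_le {v u : EuclideanSpace ℝ ι} (h : ∀ k, |v k| ≤ |u k|) :
    ‖v‖ ≤ ‖u‖ := by
  rw [EuclideanSpace.norm_eq, EuclideanSpace.norm_eq]
  refine Real.sqrt_le_sqrt (sum_le_sum fun k _ => ?_)
  simpa using sq_le_sq.2 (h k)

theorem posVec_nonneg {ι : Type*} (v : EuclideanSpace ℝ ι) (k : ι) : 0 ≤ posVec v k := le_max_right _ _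

theorem norm_posVec_le (v : EuclideanSpace ℝ ι) : ‖posVec v‖ ≤ ‖v‖ :=
  norm_le_norm_of_abs_le fun k => by
    rw [abs_of_nonneg (posVec_nonneg v k)]
    exact max_le (le_abs_self _) (abs_nonneg _)

theorem norm_posVec_sub_le (v u : EuclideanSpace ℝ ι) :
    ‖posVec v - posVec u‖ ≤ ‖v - u‖ :=
  norm_le_norm_of_abs_le fun k => by
    simpa [posVec] using abs_max_sub_max_le_abs (v k) (u k) 0

theorem posVec_eq_self {ι : Type*} {u : EuclideanSpace ℝ ι} (hu : ∀ k, 0 ≤ u k) : posVec u = u := by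
  ext k; exact max_eq_left (hu k)

theorem inner_nonneg_of_nonneg {v u : EuclideanSpace ℝ ι} (hv : ∀ k, 0 ≤ v k)
    (hu : ∀ k, 0 ≤ u k) : (0 : ℝ) ≤ inner ℝ v u := by
  rw [PiLp.inner_apply]
  exact sum_nonneg fun k _ => by simpa using mul_nonneg (hu k) (hv k)

/-- The all-ones vector. -/
noncomputable def ones (ι : Type*) : EuclideanSpace ℝ ι := WithLp.toLp 2 fun _ => 1

/-- The right side is the `ℓ¹` norm. Hence one fixed multiple of `ones` can serve as dual comparator
at all times, with no need to follow the direction of the violation. -/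
theorem norm_le_inner_ones {v : EuclideanSpace ℝ ι} (hv : ∀ k, 0 ≤ v k) :
    ‖v‖ ≤ inner ℝ (ones ι) v := by
  have h1 : (inner ℝ (ones ι) v : ℝ) = ∑ k, v k := by
    rw [PiLp.inner_apply]; simp [ones]
  rw [h1, EuclideanSpace.norm_eq]
  refine Real.sqrt_le_iff.2 ⟨sum_nonneg fun k _ => hv k, ?_⟩
  simp only [Real.norm_eq_abs, sq_abs]
  exact sum_sq_le_sq_sum_of_nonneg fun k _ => hv k

theorem norm_le_mul_norm_ones {v : EuclideanSpace ℝ ι} {c : ℝ} (hc : 0 ≤ c)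
    (hv : ∀ k, |v k| ≤ c) : ‖v‖ ≤ c * ‖ones ι‖ := by
  calc ‖v‖ ≤ ‖c • ones ι‖ := norm_le_norm_of_abs_le fun k => by
        simpa [ones, abs_of_nonneg hc] using hv k
    _ = _ := by rw [norm_smul, Real.norm_of_nonneg hc]

end PosVec

/-! ### Regret of the regularized dual recursion -/

section Dual

variable {ι : Type*} [Fintype ι] {q b : ℕ → EuclideanSpace ℝ ι} {β γ : ℕ → ℝ} {M : ℝ}

/-- Before the positive part, the update multiplied by `β` is a convex combination, with weights `1
- β γ` and `β γ`, of `β q` and `b`; both have norm at most `M`. -/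
theorem dual_norm_le (hβ : ∀ t ≥ 1, 0 < β t) (hγ : ∀ t ≥ 1, 0 < γ t)
    (hβγ : ∀ t ≥ 1, β t * γ t ≤ 1) (hanti : ∀ t ≥ 1, β (t + 1) ≤ β t)
    (hq1 : q 1 = 0) (hq : ∀ t ≥ 1, q (t + 1) =
      posVec ((1 - β (t + 1) * γ (t + 1)) • q t + γ (t + 1) • b t))
    (hb : ∀ t ≥ 1, ‖b t‖ ≤ M) {t : ℕ} (ht : 1 ≤ t) : β t * ‖q t‖ ≤ M := by
  induction t, ht using Nat.le_induction with
  | base => rw [hq1]; simpa using (norm_nonneg _).trans (hb 1 le_rfl)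
  | succ t ht ih =>
    have hb' := hβ (t + 1) (by omega)
    have hg' := hγ (t + 1) (by omega)
    have h1 : 0 ≤ 1 - β (t + 1) * γ (t + 1) := sub_nonneg.2 (hβγ _ (by omega))
    have h2 : β (t + 1) * ‖q t‖ ≤ M :=
      (mul_le_mul_of_nonneg_right (hanti t ht) (norm_nonneg _)).trans ih
    have h3 : ‖q (t + 1)‖ ≤ (1 - β (t + 1) * γ (t + 1)) * ‖q t‖ + γ (t + 1) * M := by
      rw [hq t ht]
      refine (norm_posVec_le _).trans ((norm_add_le _ _).trans ?_)
      rw [norm_smul, norm_smul, Real.norm_of_nonneg h1, Real.norm_of_nonneg hg'.le]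
      gcongr
      exact hb t ht
    calc β (t + 1) * ‖q (t + 1)‖ ≤
        β (t + 1) * ((1 - β (t + 1) * γ (t + 1)) * ‖q t‖ + γ (t + 1) * M) := by gcongr
      _ = (1 - β (t + 1) * γ (t + 1)) * (β (t + 1) * ‖q t‖) + β (t + 1) * γ (t + 1) * M := by
        ring
      _ ≤ (1 - β (t + 1) * γ (t + 1)) * M + β (t + 1) * γ (t + 1) * M := by gcongr
      _ = M := by ring

/-- The recursion is projected gradient ascent with step `γ` on `⟨·, b⟩ - β/2 ‖·‖²`. Strong
concavity pays for the growth of `1 / γ` (this is `htel`), so the distances telescope; the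
regularizer costs `β ‖u‖² / 2` per step. -/
theorem sum_inner_dual_le (hβ : ∀ t ≥ 1, 0 < β t) (hγ : ∀ t ≥ 1, 0 < γ t)
    (hβγ : ∀ t ≥ 1, β t * γ t ≤ 1) (hanti : ∀ t ≥ 1, β (t + 1) ≤ β t)
    (htel : ∀ t ≥ 1, 1 / γ (t + 1) - β (t + 1) ≤ 1 / γ t)
    (hq1 : q 1 = 0) (hq : ∀ t ≥ 1, q (t + 1) =
      posVec ((1 - β (t + 1) * γ (t + 1)) • q t + γ (t + 1) • b t))
    (hb : ∀ t ≥ 1, ‖b t‖ ≤ M) {u : EuclideanSpace ℝ ι} (hu : ∀ k, 0 ≤ u k) (T : ℕ) :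
    ∑ t ∈ range T, inner ℝ (u - q (t + 1)) (b (t + 1)) ≤
      ‖u‖ ^ 2 / 2 * (1 / γ 1 + ∑ t ∈ range T, β (t + 2)) +
        2 * M ^ 2 * ∑ t ∈ range T, γ (t + 2) := by
  have hstep : ∀ t, (inner ℝ (u - q (t + 1)) (b (t + 1)) : ℝ) ≤
      (1 / γ (t + 1) * ‖q (t + 1) - u‖ ^ 2 - 1 / γ (t + 2) * ‖q (t + 2) - u‖ ^ 2) / 2 +
      (‖u‖ ^ 2 / 2 * β (t + 2) + 2 * M ^ 2 * γ (t + 2)) := by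
    intro t
    have hM := dual_norm_le hβ hγ hβγ hanti hq1 hq hb (t := t + 1) (by omega)
    have hbt := hb (t + 1) (by omega)
    have hg := hγ (t + 2) (by omega)
    have hbp := hβ (t + 2) (by omega)
    have ht := htel (t + 1) (by omega)
    have ha := hanti (t + 1) (by omega)
    have hqt := hq (t + 1) (by omega)
    simp only [add_assoc, one_add_one_eq_two] at ht ha hqt
    generalize hQ : q (t + 1) = Q at *
    generalize hQ' : q (t + 2) = Q' at *
    generalize hb' : b (t + 1) = b' at *
    generalize γ (t + 2) = g' at *
    generalize β (t + 2) = β' at *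
    have h1 : ‖Q' - u‖ ≤ ‖(Q - u) + g' • (b' - β' • Q)‖ := by
      have h2 := norm_posVec_sub_le ((1 - β' * g') • Q + g' • b') u
      rw [posVec_eq_self hu, ← hqt] at h2
      refine h2.trans_eq ?_
      congr 1
      rw [sub_smul, one_smul, smul_sub, smul_smul, mul_comm β']
      abel
    have h2 : ‖b' - β' • Q‖ ≤ 2 * M := by
      refine (norm_sub_le _ _).trans ?_
      rw [norm_smul, Real.norm_of_nonneg hbp.le]
      have : β' * ‖Q‖ ≤ M := (mul_le_mul_of_nonneg_right ha (norm_nonneg _)).trans hM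
      linarith
    have h3 : ‖Q' - u‖ ^ 2 ≤ ‖Q - u‖ ^ 2 + 2 * g' * inner ℝ (Q - u) (b' - β' • Q) +
        g' ^ 2 * (4 * M ^ 2) := by
      calc ‖Q' - u‖ ^ 2 ≤ ‖(Q - u) + g' • (b' - β' • Q)‖ ^ 2 := by gcongr
        _ = ‖Q - u‖ ^ 2 + 2 * g' * inner ℝ (Q - u) (b' - β' • Q) +
            g' ^ 2 * ‖b' - β' • Q‖ ^ 2 := by
          rw [norm_add_sq_real, inner_smul_right, norm_smul, Real.norm_of_nonneg hg.le]; ring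
        _ ≤ _ := by
          have : ‖b' - β' • Q‖ ^ 2 ≤ (2 * M) ^ 2 := by gcongr
          have h5 := mul_le_mul_of_nonneg_left this (sq_nonneg g')
          linarith
    -- Polarization of `⟨Q - u, Q⟩`. The term in `‖Q - u‖²` is the gain from strong concavity; the
    -- one in `‖Q‖²` has a favourable sign and is dropped below.
    have h4 : (inner ℝ (Q - u) (b' - β' • Q) : ℝ) =
        - inner ℝ (u - Q) b' - β' / 2 * (‖Q‖ ^ 2 + ‖Q - u‖ ^ 2 - ‖u‖ ^ 2) := by
      rw [inner_sub_right, inner_smul_right, norm_sub_sq_real, inner_sub_left, inner_sub_left,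
        inner_sub_left, real_inner_self_eq_norm_sq, real_inner_comm u Q]
      ring
    rw [h4] at h3
    have h6 : (inner ℝ (u - Q) b' : ℝ) ≤ ((1 / g' - β') * ‖Q - u‖ ^ 2 -
        1 / g' * ‖Q' - u‖ ^ 2) / 2 + (‖u‖ ^ 2 / 2 * β' + 2 * M ^ 2 * g') := by
      have h7 : 2 * g' * inner ℝ (u - Q) b' ≤ 2 * g' * (((1 / g' - β') * ‖Q - u‖ ^ 2 -
        1 / g' * ‖Q' - u‖ ^ 2) / 2 + (‖u‖ ^ 2 / 2 * β' + 2 * M ^ 2 * g')) := by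
        have e : 2 * g' * (((1 / g' - β') * ‖Q - u‖ ^ 2 -
          1 / g' * ‖Q' - u‖ ^ 2) / 2 + (‖u‖ ^ 2 / 2 * β' + 2 * M ^ 2 * g')) =
          (1 - g' * β') * ‖Q - u‖ ^ 2 - ‖Q' - u‖ ^ 2 + g' * β' * ‖u‖ ^ 2 +
            4 * M ^ 2 * g' ^ 2 := by
          field_simp
          ring
        rw [e]
        have : 0 ≤ g' * β' * ‖Q‖ ^ 2 := by positivity
        nlinarith
      exact le_of_mul_le_mul_left h7 (by positivity)
    have h8 := mul_le_mul_of_nonneg_right ht (sq_nonneg ‖Q - u‖)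
    linarith
  refine (sum_le_sum fun t _ => hstep t).trans ?_
  rw [sum_add_distrib, sum_add_distrib, ← sum_div,
    sum_range_sub' (fun t => 1 / γ (t + 1) * ‖q (t + 1) - u‖ ^ 2), ← mul_sum, ← mul_sum]
  have h1 : 0 ≤ 1 / γ (T + 1) * ‖q (T + 1) - u‖ ^ 2 := by
    have := hγ (T + 1) (by omega)
    positivity
  simp only [zero_add, hq1, zero_sub, norm_neg]
  linarith

end Dual

/-! ### One primal step of a single agent -/

section Agent

theorem IsProj.inner_le {E : Type*} [NormedAddCommGroup E] [InnerProductSpace ℝ E] {K : Set E}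
    (hK : Convex ℝ K) {v x : E} (h : IsProj K v x) {y : E} (hy : y ∈ K) :
    inner ℝ (v - x) (y - x) ≤ (0 : ℝ) := by
  refine (norm_eq_iInf_iff_real_inner_le_zero hK h.1).1 ?_ y hy
  have : Nonempty K := ⟨⟨x, h.1⟩⟩
  refine le_antisymm (le_ciInf fun w => h.2 w w.2) ?_
  exact ciInf_le (f := fun w : K => ‖v - w‖) ⟨0, by rintro _ ⟨w, rfl⟩; exact norm_nonneg _⟩
    ⟨x, h.1⟩

/-- Three-point inequality for a projected step. -/
theorem IsProj.step_le {E : Type*} [NormedAddCommGroup E] [InnerProductSpace ℝ E] {K : Set E}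
    (hK : Convex ℝ K) {z d x : E} {a : ℝ} (ha : 0 < a) (h : IsProj K (z - a • d) x) {y : E}
    (hy : y ∈ K) :
    inner ℝ d (x - y) ≤ 1 / (2 * a) * (‖z - y‖ ^ 2 - ‖x - y‖ ^ 2 - ‖x - z‖ ^ 2) := by
  have h1 := h.inner_le hK hy
  have h2 : inner ℝ (z - a • d - x) (y - x) =
      inner ℝ (z - x) (y - x) + a * (inner ℝ d (x - y) : ℝ) := by
    rw [sub_right_comm, inner_sub_left, inner_smul_left, ← neg_sub x y, inner_neg_right d]
    simp
  have h3 : ‖z - y‖ ^ 2 = ‖x - z‖ ^ 2 + ‖x - y‖ ^ 2 - 2 * inner ℝ (z - x) (y - x) := by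
    have e : z - y = (z - x) - (y - x) := by abel
    rw [e, norm_sub_sq_real, norm_sub_rev z x, norm_sub_rev y x]; ring
  rw [h3]
  have h4 : a * (inner ℝ d (x - y) : ℝ) ≤ - inner ℝ (z - x) (y - x) := by linarith
  have h5 : (inner ℝ d (x - y) : ℝ) ≤ - inner ℝ (z - x) (y - x) / a := by
    rw [le_div_iff₀ ha]; linarith
  refine h5.trans_eq ?_
  field_simp
  ring

variable {n p : ℕ} {m : Fin n → ℕ} {X : Set (Vec p)} {f : Fin n → ℕ → Vec p → ℝ}
  {g : (i : Fin n) → ℕ → Vec p → Vec (m i)} {R F₁ F₂ : ℝ}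
  {W : ℕ → Matrix (Fin n) (Fin n) ℝ} {α β γ τ : ℕ → ℝ} {s : Trajectory n p m}

theorem Generated.x_mem (h : Generated X f g F₂ W α β γ τ s) (i : Fin n) {t : ℕ} (ht : 1 ≤ t) :
    s.x i t ∈ X := by
  obtain ⟨k, rfl⟩ := Nat.exists_eq_add_of_le' ht
  cases k with
  | zero => exact h.init_x i
  | succ k => exact (h.primal i (k + 1) (by omega)).1

theorem Generated.xhat_mem (h : Generated X f g F₂ W α β γ τ s) (i : Fin n) {t : ℕ}
    (ht : 1 ≤ t) : s.xhat i t ∈ X := by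
  induction t, ht using Nat.le_induction with
  | base => rw [h.init_xhat]; exact h.init_x i
  | succ t ht ih =>
    rcases le_or_gt (τ (t + 1)) ‖s.x i (t + 1) - s.xhat i t‖ with hc | hc
    · rw [h.trigger i t ht hc]; exact h.x_mem i (by omega)
    · rw [h.no_trigger i t ht hc]; exact ih

theorem Generated.norm_xhat_sub_le (h : Generated X f g F₂ W α β γ τ s) (hτ : ∀ t ≥ 1, 0 ≤ τ t)
    (i : Fin n) {t : ℕ} (ht : 1 ≤ t) : ‖s.xhat i t - s.x i t‖ ≤ τ t := by
  obtain ⟨k, rfl⟩ := Nat.exists_eq_add_of_le' ht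
  cases k with
  | zero => simpa [h.init_xhat] using hτ 1 le_rfl
  | succ k =>
    rcases le_or_gt (τ (k + 1 + 1)) ‖s.x i (k + 1 + 1) - s.xhat i (k + 1)‖ with hc | hc
    · rw [h.trigger i _ (by omega) hc]; simpa using hτ _ (by omega)
    · rw [h.no_trigger i _ (by omega) hc, norm_sub_rev]; exact hc.le

theorem Generated.q_nonneg (h : Generated X f g F₂ W α β γ τ s) (i : Fin n) {t : ℕ}
    (ht : 1 ≤ t) (k : Fin (m i)) : 0 ≤ s.q i t k := by
  obtain ⟨l, rfl⟩ := Nat.exists_eq_add_of_le' ht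
  cases l with
  | zero => simp [h.init_q]
  | succ l => rw [h.dual i _ (by omega)]; exact posVec_nonneg _ k

theorem ConvexProblem.norm_sub_le (h : ConvexProblem X f g R F₁ F₂) {x y : Vec p} (hx : x ∈ X)
    (hy : y ∈ X) : ‖x - y‖ ≤ 2 * R := by
  have := _root_.norm_sub_le x y
  have h1 := h.bounded x hx
  have h2 := h.bounded y hy
  linarith

theorem ConvexProblem.loss_sub_le (h : ConvexProblem X f g R F₁ F₂) (i : Fin n) {t : ℕ}
    (ht : 1 ≤ t) {x y : Vec p} (hx : x ∈ X) (hy : y ∈ X) :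
    f i t x - f i t y ≤ F₂ * ‖x - y‖ := by
  obtain ⟨v, hv, hb⟩ := h.loss_subgradient i t ht x hx
  have h1 := hv y hy
  have h2 := abs_le.1 (abs_real_inner_le_norm v (y - x))
  rw [norm_sub_rev x y]
  have := mul_le_mul_of_nonneg_right hb (norm_nonneg (y - x))
  linarith

/-- Each component is `F₂`-Lipschitz on `X`, by subgradients at either point. Reassembling the
components costs the factor `‖ones‖`. -/
theorem ConvexProblem.posVec_constraint_le (h : ConvexProblem X f g R F₁ F₂) (i : Fin n) {t : ℕ}
    (ht : 1 ≤ t) {x y : Vec p} (hx : x ∈ X) (hy : y ∈ X) :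
    ‖posVec (g i t x)‖ ≤ ‖posVec (g i t y)‖ + F₂ * ‖x - y‖ * ‖ones (Fin (m i))‖ := by
  have hF : 0 ≤ F₂ := by
    obtain ⟨D, -, hb⟩ := h.constraint_subgradient i t ht x hx
    exact (norm_nonneg _).trans hb
  have key : ∀ x ∈ X, ∀ y ∈ X, ∀ k, g i t x k - g i t y k ≤ F₂ * ‖x - y‖ := by
    intro x hx y hy k
    obtain ⟨D, hD, hb⟩ := h.constraint_subgradient i t ht x hx
    have h1 := hD k y hy
    have h2 := PiLp.norm_apply_le (D (y - x)) k
    have h3 := D.le_of_opNorm_le hb (y - x)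
    rw [Real.norm_eq_abs] at h2
    have h4 := abs_le.1 h2
    rw [norm_sub_rev x y]
    linarith
  have h1 : ‖posVec (g i t x) - posVec (g i t y)‖ ≤ F₂ * ‖x - y‖ * ‖ones (Fin (m i))‖ := by
    refine (norm_posVec_sub_le _ _).trans (norm_le_mul_norm_ones (by positivity) fun k => ?_)
    rw [PiLp.sub_apply, abs_le]
    have h2 := key x hx y hy k
    have h3 := key y hy x hx k
    rw [norm_sub_rev] at h3
    constructor <;> linarith
  have h2 := norm_sub_norm_le (posVec (g i t x)) (posVec (g i t y))
  linarith

/-- The linearized constraint observed by agent `i` in its dual update. -/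
noncomputable def Trajectory.dualStep (s : Trajectory n p m)
    (g : (i : Fin n) → ℕ → Vec p → Vec (m i)) (i : Fin n) (t : ℕ) : Vec (m i) :=
  posVec (g i t (s.x i t)) + s.D i t (s.x i (t + 1) - s.x i t)

theorem Generated.norm_dualStep_le (h : Generated X f g F₂ W α β γ τ s)
    (hP : ConvexProblem X f g R F₁ F₂) (i : Fin n) {t : ℕ} (ht : 1 ≤ t) :
    ‖s.dualStep g i t‖ ≤ F₁ + F₂ * (2 * R) := by
  refine (norm_add_le _ _).trans (add_le_add ?_ ?_)
  · exact (norm_posVec_le _).trans (hP.constraint_bound i t ht _ (h.x_mem i ht))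
  · have hb := h.observe_constraint_bound i t ht
    have hF : 0 ≤ F₂ := (norm_nonneg _).trans hb
    refine ((s.D i t).le_of_opNorm_le hb _).trans (mul_le_mul_of_nonneg_left ?_ hF)
    exact hP.norm_sub_le (h.x_mem i (by omega)) (h.x_mem i ht)

/-- The three-point inequality for the projection, with both linearizations taken at `x t` but
evaluated at `x (t + 1)`. For the loss this mismatch costs `F₂ ‖x (t+1) - x t‖`. For the constraint
it costs nothing, because `dualStep` is itself extrapolated to `x (t + 1)`. -/
theorem Generated.agent_step_le (h : Generated X f g F₂ W α β γ τ s)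
    (hP : ConvexProblem X f g R F₁ F₂) (hα : ∀ t ≥ 1, 0 < α t) (i : Fin n) {t : ℕ} (ht : 1 ≤ t)
    {y : Vec p} (hy : y ∈ X) (hgy : ∀ k, g i t y k ≤ 0) :
    f i t (s.x i t) - f i t y + inner ℝ (s.q i t) (s.dualStep g i t) ≤
      1 / (2 * α (t + 1)) * (‖s.z i (t + 1) - y‖ ^ 2 - ‖s.x i (t + 1) - y‖ ^ 2 -
        ‖s.x i (t + 1) - s.z i (t + 1)‖ ^ 2) + F₂ * ‖s.x i (t + 1) - s.x i t‖ := by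
  have h1 := (h.primal i t ht).step_le hP.convex (hα (t + 1) (by omega)) hy
  have h2 := h.observe_loss i t ht y hy
  have h3 : (inner ℝ (s.u i t) (y - s.x i t) : ℝ) = - inner ℝ (s.u i t) (s.x i (t + 1) - y) +
      inner ℝ (s.u i t) (s.x i (t + 1) - s.x i t) := by
    rw [← inner_neg_right, ← inner_add_right]; congr 1; abel
  have h4 : - (F₂ * ‖s.x i (t + 1) - s.x i t‖) ≤
      inner ℝ (s.u i t) (s.x i (t + 1) - s.x i t) := by
    have h5 := abs_le.1 (abs_real_inner_le_norm (s.u i t) (s.x i (t + 1) - s.x i t))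
    have h6 := mul_le_mul_of_nonneg_right (h.observe_loss_bound i t ht)
      (norm_nonneg (s.x i (t + 1) - s.x i t))
    linarith
  have h7 : (inner ℝ (s.q i t) (s.dualStep g i t) : ℝ) ≤
      inner ℝ (s.q i t) (s.D i t (s.x i (t + 1) - y)) := by
    rw [← sub_nonneg, ← inner_sub_right]
    -- Feasibility of `y` makes `[g y]₊` vanish, so the subgradient inequality at `x t` gives
    -- `dualStep ≤ D (x (t + 1) - y)` in every component.
    refine inner_nonneg_of_nonneg (h.q_nonneg i ht) fun k => ?_
    have h8 := h.observe_constraint i t ht k y hy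
    have h9 : posVec (g i t y) k = 0 := max_eq_right (hgy k)
    have e : s.x i (t + 1) - y = (s.x i (t + 1) - s.x i t) - (y - s.x i t) := by abel
    rw [h9] at h8
    rw [e, map_sub, Trajectory.dualStep]
    simp only [PiLp.sub_apply, PiLp.add_apply]
    linarith
  rw [h.direction i t ht, inner_add_left, ContinuousLinearMap.adjoint_inner_left] at h1
  linarith

end Agent

/-! ### Movement, consensus error and disagreement of the whole network -/

section Mixing

variable {n p : ℕ} {m : Fin n → ℕ} {X : Set (Vec p)} {f : Fin n → ℕ → Vec p → ℝ}
  {g : (i : Fin n) → ℕ → Vec p → Vec (m i)} {R F₁ F₂ w : ℝ} {B : ℕ} {G : ℕ → Digraph (Fin n)}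
  {W : ℕ → Matrix (Fin n) (Fin n) ℝ} {α β γ τ : ℕ → ℝ} {s : Trajectory n p m}

/-- Total distance of the decisions at time `t` to their average. -/
noncomputable def Trajectory.disagreement (s : Trajectory n p m) (t : ℕ) : ℝ :=
  ∑ i, ‖s.x i t - (1 / (n : ℝ)) • ∑ j, s.x j t‖

/-- Total distance between the decisions and the consensus variables at time `t + 1`. -/
noncomputable def Trajectory.residual (s : Trajectory n p m) (t : ℕ) : ℝ :=
  ∑ i, ‖s.x i (t + 1) - s.z i (t + 1)‖

theorem Trajectory.disagreement_nonneg (s : Trajectory n p m) (t : ℕ) : 0 ≤ s.disagreement t :=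
  sum_nonneg fun _ _ => norm_nonneg _

theorem Trajectory.residual_nonneg (s : Trajectory n p m) (t : ℕ) : 0 ≤ s.residual t :=
  sum_nonneg fun _ _ => norm_nonneg _

theorem Trajectory.sum_sum_norm_sub_le (s : Trajectory n p m) (t : ℕ) :
    ∑ i, ∑ j, ‖s.x i t - s.x j t‖ ≤ 2 * n * s.disagreement t := by
  set a := (1 / (n : ℝ)) • ∑ j, s.x j t with ha
  calc ∑ i, ∑ j, ‖s.x i t - s.x j t‖ ≤ ∑ i, ∑ j, (‖s.x i t - a‖ + ‖s.x j t - a‖) := by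
        refine sum_le_sum fun i _ => sum_le_sum fun j _ => ?_
        rw [norm_sub_rev (s.x j t) a]
        exact norm_sub_le_norm_sub_add_norm_sub _ _ _
    _ = 2 * n * s.disagreement t := by
        simp only [sum_add_distrib, sum_const, card_univ, Fintype.card_fin, nsmul_eq_mul,
          ← mul_sum, disagreement, ← ha]
        ring

theorem mix_sub_const (hW : MixingNetwork G W w B) {t : ℕ} (ht : 1 ≤ t) (i : Fin n)
    (v : Fin n → Vec p) (y : Vec p) : ∑ j, W t i j • v j - y = ∑ j, W t i j • (v j - y) := by
  simp only [smul_sub, sum_sub_distrib, ← sum_smul, hW.row_sum t ht, one_smul]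

theorem norm_mix_le (hW : MixingNetwork G W w B) {t : ℕ} (ht : 1 ≤ t) (i : Fin n)
    (v : Fin n → Vec p) : ‖∑ j, W t i j • v j‖ ≤ ∑ j, W t i j * ‖v j‖ :=
  (norm_sum_le _ _).trans (sum_le_sum fun j _ => by
    rw [norm_smul, Real.norm_of_nonneg (hW.nonneg ht i j)])

theorem sum_mix (hW : MixingNetwork G W w B) {t : ℕ} (ht : 1 ≤ t) (a : Fin n → ℝ) :
    ∑ i, ∑ j, W t i j * a j = ∑ j, a j := by
  rw [sum_comm]
  simp only [← sum_mul, hW.col_sum t ht, one_mul]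

/-- The path from `x (t + 1)` to `x t` runs through `z (t + 1)` and the average of the decisions at
time `t`. Broadcasts are within `τ t` of decisions, and unit column sums keep the mixed errors from
growing. -/
theorem Generated.sum_norm_step_le (h : Generated X f g F₂ W α β γ τ s)
    (hW : MixingNetwork G W w B) (hτ : ∀ t ≥ 1, 0 ≤ τ t) {t : ℕ} (ht : 1 ≤ t) :
    ∑ i, ‖s.x i (t + 1) - s.x i t‖ ≤ s.residual t + n * τ t + 2 * s.disagreement t := by
  set a := (1 / (n : ℝ)) • ∑ j, s.x j t with ha
  have h1 : ∀ i, ‖s.x i (t + 1) - s.x i t‖ ≤ ‖s.x i (t + 1) - s.z i (t + 1)‖ +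
      ((∑ j, W t i j * (τ t + ‖s.x j t - a‖)) + ‖s.x i t - a‖) := by
    intro i
    have h2 : ‖s.z i (t + 1) - a‖ ≤ ∑ j, W t i j * (τ t + ‖s.x j t - a‖) := by
      rw [h.consensus i t ht, mix_sub_const hW ht]
      refine (norm_mix_le hW ht i _).trans (sum_le_sum fun j _ => ?_)
      refine mul_le_mul_of_nonneg_left ?_ (hW.nonneg ht i j)
      have h3 := h.norm_xhat_sub_le hτ j ht
      have h4 := norm_sub_le_norm_sub_add_norm_sub (s.xhat j t) (s.x j t) a
      linarith
    have h3 := norm_sub_le_norm_sub_add_norm_sub (s.x i (t + 1)) (s.z i (t + 1)) (s.x i t)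
    have h4 := norm_sub_le_norm_sub_add_norm_sub (s.z i (t + 1)) a (s.x i t)
    rw [norm_sub_rev a] at h4
    linarith
  refine (sum_le_sum fun i _ => h1 i).trans_eq ?_
  rw [sum_add_distrib, sum_add_distrib, sum_mix hW ht, sum_add_distrib]
  simp only [sum_const, card_univ, Fintype.card_fin, nsmul_eq_mul, Trajectory.residual,
    Trajectory.disagreement, ← ha]
  ring

/-- Jensen in each row, then the column sums. Replacing a broadcast by the decision changes the
square by at most `τ t · 4R`, from `a² - b² = (a - b)(a + b)`. -/
theorem Generated.sum_sq_consensus_le (h : Generated X f g F₂ W α β γ τ s)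
    (hP : ConvexProblem X f g R F₁ F₂) (hW : MixingNetwork G W w B) (hτ : ∀ t ≥ 1, 0 ≤ τ t)
    {t : ℕ} (ht : 1 ≤ t) {y : Vec p} (hy : y ∈ X) :
    ∑ i, ‖s.z i (t + 1) - y‖ ^ 2 ≤ ∑ i, ‖s.x i t - y‖ ^ 2 + n * (4 * R * τ t) := by
  have h1 : ∀ i, ‖s.z i (t + 1) - y‖ ^ 2 ≤ ∑ j, W t i j * ‖s.xhat j t - y‖ ^ 2 := by
    intro i
    rw [h.consensus i t ht, mix_sub_const hW ht]
    have hc : ConvexOn ℝ Set.univ fun v : Vec p => ‖v‖ ^ 2 :=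
      convexOn_univ_norm.pow (fun _ _ => norm_nonneg _) 2
    have := hc.map_sum_le (t := univ) (w := fun j => W t i j) (p := fun j => s.xhat j t - y)
      (fun j _ => hW.nonneg ht i j) (hW.row_sum t ht i) (fun _ _ => Set.mem_univ _)
    simpa using this
  refine (sum_le_sum fun i _ => h1 i).trans ?_
  rw [sum_mix hW ht]
  calc ∑ j, ‖s.xhat j t - y‖ ^ 2 ≤ ∑ j, (‖s.x j t - y‖ ^ 2 + 4 * R * τ t) := by
        refine sum_le_sum fun j _ => ?_
        have h2 := h.norm_xhat_sub_le hτ j ht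
        have h3 := norm_sub_le_norm_sub_add_norm_sub (s.xhat j t) (s.x j t) y
        have h4 := hP.norm_sub_le (h.xhat_mem j ht) hy
        have h5 := hP.norm_sub_le (h.x_mem j ht) hy
        have h6 := norm_nonneg (s.xhat j t - y)
        have h7 := norm_nonneg (s.x j t - y)
        have h8 := hτ t ht
        nlinarith [mul_le_mul_of_nonneg_right (h3.trans (add_le_add_left h2 _)) (add_nonneg h6 h7),
          mul_le_mul_of_nonneg_left (add_le_add h4 h5) h8]
    _ = _ := by simp [sum_add_distrib]

/-- The deviations from the average sum to zero and follow the mixing recursion up to the centred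
part of `x (t + 1) - ∑ W x`. Centring at most doubles the sum of norms, whence the factor 2. -/
theorem Generated.sum_disagreement_le (h : Generated X f g F₂ W α β γ τ s)
    (hP : ConvexProblem X f g R F₁ F₂) (hn : 0 < n) (hw : 0 < w) (hW : MixingNetwork G W w B)
    (hτ : ∀ t ≥ 1, 0 ≤ τ t) (T : ℕ) :
    w ^ (n * B) * ∑ t ∈ range T, s.disagreement (t + 1) ≤ (n * B : ℕ) *
      (n * (2 * R) + ∑ t ∈ range T, 2 * (s.residual (t + 1) + n * τ (t + 1))) := by
  have hn0 : (n : ℝ) ≠ 0 := by exact_mod_cast hn.ne'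
  set a : ℕ → Vec p := fun t => (1 / (n : ℝ)) • ∑ j, s.x j t with ha
  have hsum : ∀ v : Fin n → Vec p, ∑ i, (v i - (1 / (n : ℝ)) • ∑ j, v j) = 0 := by
    intro v
    rw [sum_sub_distrib, sum_const, card_univ, Fintype.card_fin, ← Nat.cast_smul_eq_nsmul ℝ,
      smul_smul, mul_one_div_cancel hn0, one_smul, sub_self]
  have hcent : ∀ v : Fin n → Vec p,
      ∑ i, ‖v i - (1 / (n : ℝ)) • ∑ j, v j‖ ≤ 2 * ∑ i, ‖v i‖ := by
    intro v
    have h1 : ∀ i, ‖v i - (1 / (n : ℝ)) • ∑ j, v j‖ ≤ ‖v i‖ + (1 / (n : ℝ)) * ∑ j, ‖v j‖ := by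
      intro i
      refine (_root_.norm_sub_le _ _).trans (add_le_add_right ?_ _)
      rw [norm_smul, Real.norm_of_nonneg (by positivity)]
      gcongr
      exact norm_sum_le _ _
    refine (sum_le_sum fun i _ => h1 i).trans_eq ?_
    rw [sum_add_distrib, sum_const, card_univ, Fintype.card_fin, nsmul_eq_mul]
    field_simp
    ring
  -- The general lemma wants `δ ≥ 0` at every index, while `τ` is only known to be nonnegative from
  -- time 1 on.
  let δ : ℕ → ℝ := fun t => if 1 ≤ t then 2 * (s.residual t + n * τ t) else 0
  have hmain := EventTriggered.sum_disagreement_le (y := fun i t => s.x i t - a t) (δ := δ)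
    (M := n * (2 * R)) hn hW hw ?_ ?_ ?_ ?_ T
  · simpa [δ, Trajectory.disagreement, ha] using hmain
  · intro t
    simp only [δ]
    split_ifs with ht
    · have := s.residual_nonneg t
      have := hτ t ht
      positivity
    · exact le_rfl
  · intro t ht
    simp only [δ, if_pos (show 1 ≤ t from ht)]
    have h1 : ∀ i, s.x i (t + 1) - a (t + 1) - ∑ j, W t i j • (s.x j t - a t) =
        (s.x i (t + 1) - ∑ j, W t i j • s.x j t) -
          (1 / (n : ℝ)) • ∑ k, (s.x k (t + 1) - ∑ j, W t k j • s.x j t) := by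
      intro i
      have h2 : ∑ k, ∑ j, W t k j • s.x j t = ∑ j, s.x j t := by
        rw [sum_comm]
        simp only [← sum_smul, hW.col_sum t ht, one_smul]
      rw [← mix_sub_const hW ht, sum_sub_distrib, h2, smul_sub]
      simp only [ha]
      abel
    simp only [h1]
    refine (hcent _).trans (mul_le_mul_of_nonneg_left ?_ zero_le_two)
    have h3 : ∀ i, ‖s.x i (t + 1) - ∑ j, W t i j • s.x j t‖ ≤
        ‖s.x i (t + 1) - s.z i (t + 1)‖ + τ t := by
      intro i
      have h4 : ‖s.z i (t + 1) - ∑ j, W t i j • s.x j t‖ ≤ τ t := by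
        rw [h.consensus i t ht, ← sum_sub_distrib]
        simp only [← smul_sub]
        refine (norm_mix_le hW ht i _).trans ?_
        calc _ ≤ ∑ j, W t i j * τ t := sum_le_sum fun j _ =>
              mul_le_mul_of_nonneg_left (h.norm_xhat_sub_le hτ j ht) (hW.nonneg ht i j)
          _ = τ t := by rw [← sum_mul, hW.row_sum t ht, one_mul]
      have := norm_sub_le_norm_sub_add_norm_sub (s.x i (t + 1)) (s.z i (t + 1))
        (∑ j, W t i j • s.x j t)
      linarith
    refine (sum_le_sum fun i _ => h3 i).trans_eq ?_
    simp [sum_add_distrib, Trajectory.residual]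
  · intro t _
    exact hsum _
  · intro t ht
    calc _ ≤ ∑ i : Fin n, 2 * R := sum_le_sum fun i _ => ?_
      _ = _ := by simp
    have h1 : s.x i t - a t = (1 / (n : ℝ)) • ∑ j, (s.x i t - s.x j t) := by
      rw [sum_sub_distrib, sum_const, card_univ, Fintype.card_fin, ← Nat.cast_smul_eq_nsmul ℝ,
        smul_sub, smul_smul, one_div_mul_cancel hn0, one_smul]
    change ‖s.x i t - a t‖ ≤ 2 * R
    rw [h1, norm_smul, Real.norm_of_nonneg (by positivity)]
    calc 1 / (n : ℝ) * ‖∑ j, (s.x i t - s.x j t)‖ ≤ 1 / (n : ℝ) * ∑ j : Fin n, 2 * R := by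
          gcongr
          exact (norm_sum_le _ _).trans (sum_le_sum fun j _ =>
            hP.norm_sub_le (h.x_mem i ht) (h.x_mem j ht))
      _ = 2 * R := by simp; field_simp

/-- Weighted telescoping against a drifting comparator. -/
theorem sum_weighted_drift_le {a c e η : ℕ → ℝ} {D : ℝ} (hη0 : 0 ≤ η 0)
    (hη : ∀ t, η t ≤ η (t + 1)) (hc : ∀ t, 0 ≤ c t) (N : ℕ) (ha : ∀ t ≤ N, a t ≤ D)
    (hac : ∀ t < N, a (t + 1) ≤ c t + e t) :
    ∑ t ∈ range (N + 1), η t * (a t - c t) ≤ η N * D + ∑ t ∈ range N, η t * e t := by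
  have hηn : ∀ t, 0 ≤ η t := fun t => by
    induction t with
    | zero => exact hη0
    | succ t ih => exact ih.trans (hη t)
  -- The induction closes only if the last term `η N * c N` is kept: it meets the next `a (N + 1)`.
  suffices hs : ∑ t ∈ range (N + 1), η t * (a t - c t) ≤
      η N * D - η N * c N + ∑ t ∈ range N, η t * e t by
    have := mul_nonneg (hηn N) (hc N)
    linarith
  induction N with
  | zero =>
    have := mul_le_mul_of_nonneg_left (ha 0 le_rfl) (hηn 0)
    simp only [zero_add, sum_range_one, range_zero, sum_empty]
    linarith
  | succ N ih =>
    have h1 := ih (fun t ht => ha t (by omega)) (fun t ht => hac t (by omega))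
    rw [sum_range_succ _ (N + 1), sum_range_succ (fun t => η t * e t) N]
    have h2 := mul_le_mul_of_nonneg_left (hac N (by omega)) (hηn N)
    have h3 := mul_le_mul_of_nonneg_left (ha (N + 1) le_rfl) (sub_nonneg.2 (hη N))
    linarith

end Mixing

/-! ### The basic inequality: regret plus weighted violation -/

section Bound

variable {n p : ℕ} {m : Fin n → ℕ} {X : Set (Vec p)} {f : Fin n → ℕ → Vec p → ℝ}
  {g : (i : Fin n) → ℕ → Vec p → Vec (m i)} {R F₁ F₂ w : ℝ} {B : ℕ} {G : ℕ → Digraph (Fin n)}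
  {W : ℕ → Matrix (Fin n) (Fin n) ℝ} {α β γ τ : ℕ → ℝ} {s : Trajectory n p m}

/-- Positivity and monotonicity of the algorithm's parameters. -/
structure Admissible (α β γ τ : ℕ → ℝ) : Prop where
  α_pos : ∀ t ≥ 1, 0 < α t
  α_anti : ∀ t ≥ 1, α (t + 1) ≤ α t
  β_pos : ∀ t ≥ 1, 0 < β t
  β_anti : ∀ t ≥ 1, β (t + 1) ≤ β t
  γ_pos : ∀ t ≥ 1, 0 < γ t
  βγ_le : ∀ t ≥ 1, β t * γ t ≤ 1
  γ_drift : ∀ t ≥ 1, 1 / γ (t + 1) - β (t + 1) ≤ 1 / γ t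
  τ_nonneg : ∀ t ≥ 1, 0 ≤ τ t

/-- One step of the primal analysis, summed over the agents; `r` is the dual comparator. -/
theorem Generated.network_step_le (h : Generated X f g F₂ W α β γ τ s)
    (hP : ConvexProblem X f g R F₁ F₂) (hW : MixingNetwork G W w B)
    (hA : Admissible α β γ τ) (hF₂ : 0 ≤ F₂) {c r : ℝ} (hr : 0 ≤ r)
    (hc : ∀ i, ‖ones (Fin (m i))‖ ≤ c) {t : ℕ} (ht : 1 ≤ t)
    {y : Vec p} (hy : y ∈ X) (hgy : ∀ i k, g i t y k ≤ 0) :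
    ∑ i, (f i t (s.x i t) - f i t y) + r * ∑ i, ‖posVec (g i t (s.x i t))‖ ≤
      1 / (2 * α (t + 1)) * (∑ i, ‖s.x i t - y‖ ^ 2 - ∑ i, ‖s.x i (t + 1) - y‖ ^ 2) +
      n * (2 * R) * (τ t / α (t + 1)) -
      1 / (2 * α (t + 1)) * ∑ i, ‖s.x i (t + 1) - s.z i (t + 1)‖ ^ 2 +
      (1 + r * c) * F₂ * (s.residual t + n * τ t + 2 * s.disagreement t) +
      ∑ i, inner ℝ (r • ones (Fin (m i)) - s.q i t) (s.dualStep g i t) := by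
  have hα := hA.α_pos (t + 1) (by omega)
  have h1 : ∀ i, f i t (s.x i t) - f i t y + r * ‖posVec (g i t (s.x i t))‖ ≤
      1 / (2 * α (t + 1)) * (‖s.z i (t + 1) - y‖ ^ 2 - ‖s.x i (t + 1) - y‖ ^ 2 -
        ‖s.x i (t + 1) - s.z i (t + 1)‖ ^ 2) +
      (1 + r * c) * F₂ * ‖s.x i (t + 1) - s.x i t‖ +
      inner ℝ (r • ones (Fin (m i)) - s.q i t) (s.dualStep g i t) := by
    intro i
    have h2 := h.agent_step_le hP hA.α_pos i ht hy (hgy i)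
    rw [inner_sub_left]
    -- Pairing `r • ones` with `dualStep` yields the violation; its linear correction is one more
    -- movement term, with factor `r c F₂`.
    have h3 : r * ‖posVec (g i t (s.x i t))‖ - r * c * F₂ * ‖s.x i (t + 1) - s.x i t‖ ≤
        inner ℝ (r • ones (Fin (m i))) (s.dualStep g i t) := by
      rw [inner_smul_left, Trajectory.dualStep, inner_add_right]
      have h4 := norm_le_inner_ones (posVec_nonneg (g i t (s.x i t)))
      have h5 : -(c * (F₂ * ‖s.x i (t + 1) - s.x i t‖)) ≤
          inner ℝ (ones (Fin (m i))) (s.D i t (s.x i (t + 1) - s.x i t)) := by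
        have h6 := abs_le.1 (abs_real_inner_le_norm (ones (Fin (m i)))
          (s.D i t (s.x i (t + 1) - s.x i t)))
        have h7 := (s.D i t).le_of_opNorm_le (h.observe_constraint_bound i t ht)
          (s.x i (t + 1) - s.x i t)
        have h8 := mul_le_mul (hc i) h7 (norm_nonneg _) ((norm_nonneg _).trans (hc i))
        linarith
      have h9 := mul_le_mul_of_nonneg_left (add_le_add h4 h5) hr
      simp only [conj_trivial]
      linarith
    linarith
  have h2 := h.sum_norm_step_le hW hA.τ_nonneg ht
  have h3 := h.sum_sq_consensus_le hP hW hA.τ_nonneg ht hy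
  have h4 := sum_le_sum fun i (_ : i ∈ univ) => h1 i
  simp only [sum_add_distrib, ← mul_sum] at h4
  rw [sum_sub_distrib (s := univ) (f := fun i => ‖s.z i (t + 1) - y‖ ^ 2 -
    ‖s.x i (t + 1) - y‖ ^ 2), sum_sub_distrib (s := univ)
    (f := fun i => ‖s.z i (t + 1) - y‖ ^ 2)] at h4
  have h5 : 0 ≤ 1 / (2 * α (t + 1)) := by positivity
  have h6 := mul_le_mul_of_nonneg_left h3 h5
  rcases Nat.eq_zero_or_pos n with rfl | hn
  · simp [Trajectory.residual, Trajectory.disagreement]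
  have hc0 : 0 ≤ c := (norm_nonneg _).trans (hc ⟨0, hn⟩)
  have h7 := mul_le_mul_of_nonneg_left h2 (show 0 ≤ (1 + r * c) * F₂ by positivity)
  have h8 : 1 / (2 * α (t + 1)) * (n * (4 * R * τ t)) = n * (2 * R) * (τ t / α (t + 1)) := by
    field_simp
    ring
  linarith

theorem Admissible.antitone (hA : Admissible α β γ τ) {a b : ℕ} (ha : 1 ≤ a) (hab : a ≤ b) :
    α b ≤ α a := by
  induction b, hab using Nat.le_induction with
  | base => exact le_rfl
  | succ b hb ih => exact (hA.α_anti b (by omega)).trans ih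

theorem feasible_mem {y : ℕ → Vec p} {T : ℕ} (hy : y ∈ feasibleSeqs X g T) {t : ℕ} (ht : t < T) :
    y (t + 1) ∈ X := (hy (t + 1) (by simp; omega)).1

theorem feasible_le {y : ℕ → Vec p} {T : ℕ} (hy : y ∈ feasibleSeqs X g T) {t : ℕ} (ht : t < T)
    (i : Fin n) (j : Fin (m i)) : g i (t + 1) (y (t + 1)) j ≤ 0 :=
  (hy (t + 1) (by simp; omega)).2 ⟨i, j⟩

theorem Generated.sum_disagreement_le_mul (h : Generated X f g F₂ W α β γ τ s)
    (hP : ConvexProblem X f g R F₁ F₂) (hn : 0 < n) (hw : 0 < w) (hW : MixingNetwork G W w B)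
    (hA : Admissible α β γ τ) (hR : 0 ≤ R) (T : ℕ) :
    ∑ t ∈ range T, s.disagreement (t + 1) ≤
      (n * B : ℕ) * (2 * n * R + 2 + 2 * n) / w ^ (n * B) *
        (1 + ∑ t ∈ range T, s.residual (t + 1) + ∑ t ∈ range T, τ (t + 1)) := by
  have h1 := h.sum_disagreement_le hP hn hw hW hA.τ_nonneg T
  rw [← mul_sum, sum_add_distrib, ← mul_sum] at h1
  have hE0 : 0 ≤ ∑ t ∈ range T, s.residual (t + 1) := sum_nonneg fun _ _ => s.residual_nonneg _
  have hΨ0 : 0 ≤ ∑ t ∈ range T, τ (t + 1) := sum_nonneg fun _ _ => hA.τ_nonneg _ (by omega)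
  generalize ∑ t ∈ range T, s.residual (t + 1) = E at *
  generalize ∑ t ∈ range T, τ (t + 1) = Ψ at *
  have hwp : 0 < w ^ (n * B) := pow_pos hw _
  rw [div_mul_eq_mul_div, le_div_iff₀ hwp, mul_comm (∑ t ∈ range T, _), mul_assoc]
  refine h1.trans (mul_le_mul_of_nonneg_left ?_ (Nat.cast_nonneg _))
  have hn0 : (0 : ℝ) ≤ n := Nat.cast_nonneg n
  have a2 : 0 ≤ (n : ℝ) * R * (E + Ψ) := by positivity
  have a3 : 0 ≤ (n : ℝ) * E := by positivity
  linarith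

theorem Generated.sum_dual_le (h : Generated X f g F₂ W α β γ τ s)
    (hP : ConvexProblem X f g R F₁ F₂) (hA : Admissible α β γ τ) {c M r : ℝ} (hr : 0 ≤ r)
    (hci : ∀ i, ‖ones (Fin (m i))‖ ≤ c) (hM : F₁ + F₂ * (2 * R) = M) (T : ℕ) :
    ∑ t ∈ range T, ∑ i, inner ℝ (r • ones (Fin (m i)) - s.q i (t + 1))
      (s.dualStep g i (t + 1)) ≤ n * (c ^ 2 / 2) * (r ^ 2 * (1 / γ 1 +
        ∑ t ∈ range T, β (t + 2))) + n * (2 * M ^ 2) * ∑ t ∈ range T, γ (t + 2) := by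
  subst hM
  rw [sum_comm]
  have hb0 : 0 ≤ 1 / γ 1 + ∑ t ∈ range T, β (t + 2) := by
    have := hA.γ_pos 1 le_rfl
    have := sum_nonneg fun t (_ : t ∈ range T) => (hA.β_pos (t + 2) (by omega)).le
    positivity
  have h1 : ∀ i, ∑ t ∈ range T, inner ℝ (r • ones (Fin (m i)) - s.q i (t + 1))
      (s.dualStep g i (t + 1)) ≤ c ^ 2 / 2 * (r ^ 2 * (1 / γ 1 +
      ∑ t ∈ range T, β (t + 2))) + 2 * (F₁ + F₂ * (2 * R)) ^ 2 * ∑ t ∈ range T, γ (t + 2) := by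
    intro i
    refine (sum_inner_dual_le (q := s.q i) (b := s.dualStep g i) hA.β_pos hA.γ_pos hA.βγ_le
      hA.β_anti hA.γ_drift (h.init_q i) (fun t ht => h.dual i t ht)
      (fun t ht => h.norm_dualStep_le hP i ht) (u := r • ones (Fin (m i)))
      (fun j => by simpa [ones] using hr) T).trans (add_le_add_left ?_ _)
    rw [norm_smul, Real.norm_of_nonneg hr, mul_pow]
    have h2 : ‖ones (Fin (m i))‖ ^ 2 ≤ c ^ 2 := by gcongr; exact hci i
    have h3 := mul_le_mul_of_nonneg_left h2 (show 0 ≤ r ^ 2 / 2 *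
      (1 / γ 1 + ∑ t ∈ range T, β (t + 2)) by positivity)
    linarith
  refine (sum_le_sum fun i _ => h1 i).trans_eq ?_
  rw [sum_const, card_univ, Fintype.card_fin, nsmul_eq_mul]
  ring

/-- The weights `1 / (2 α)` increase, so the sum telescopes up to the last weight times the squared
diameter; each move of the comparator changes a squared distance by at most `4R` times its length.
-/
theorem Generated.sum_telescope_le (h : Generated X f g F₂ W α β γ τ s)
    (hP : ConvexProblem X f g R F₁ F₂) (hA : Admissible α β γ τ) (hR : 0 ≤ R) {T : ℕ}
    (hT : 1 ≤ T) {y : ℕ → Vec p} (hy : y ∈ feasibleSeqs X g T) :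
    ∑ t ∈ range T, 1 / (2 * α (t + 2)) * (∑ i, ‖s.x i (t + 1) - y (t + 1)‖ ^ 2 -
      ∑ i, ‖s.x i (t + 2) - y (t + 1)‖ ^ 2) ≤
      n * (2 * R ^ 2) * (1 / α (T + 1)) + n * (2 * R) * (1 / α T * pathLength y T) := by
  obtain ⟨N, rfl⟩ := Nat.exists_eq_add_of_le' hT
  have h1 := sum_weighted_drift_le (a := fun t => ∑ i, ‖s.x i (t + 1) - y (t + 1)‖ ^ 2)
    (c := fun t => ∑ i, ‖s.x i (t + 2) - y (t + 1)‖ ^ 2)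
    (e := fun t => n * (4 * R) * ‖y (t + 2) - y (t + 1)‖)
    (η := fun t => 1 / (2 * α (t + 2))) (D := n * (4 * R ^ 2)) ?_ ?_ ?_ N ?_ ?_
  · refine h1.trans (add_le_add (le_of_eq ?_) ?_)
    · have := (hA.α_pos (N + 2) (by omega)).ne'
      simp only [show N + 1 + 1 = N + 2 from rfl]
      field_simp
      ring
    · rw [pathLength, sum_Ico_eq_sum_range, mul_sum, mul_sum]
      simp only [Nat.add_sub_cancel]
      refine sum_le_sum fun t ht => ?_
      rw [mem_range] at ht
      -- Here `t < N`, so `t + 2 ≤ N + 1 = T`: the path length is weighted by `1 / α T`, not by `1 /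
      -- α (T + 1)`.
      have h2 : 1 / α (t + 2) ≤ 1 / α (N + 1) :=
        one_div_le_one_div_of_le (hA.α_pos _ (by omega)) (hA.antitone (by omega) (by omega))
      have h3 := mul_le_mul_of_nonneg_left h2
        (show 0 ≤ n * (2 * R) * ‖y (t + 2) - y (t + 1)‖ by positivity)
      have e1 : 1 + t + 1 = t + 2 := by ring
      have e2 : 1 + t = t + 1 := by ring
      rw [e1, e2]
      have e3 : 1 / (2 * α (t + 2)) = 1 / 2 * (1 / α (t + 2)) := by
        have := (hA.α_pos (t + 2) (by omega)).ne'
        field_simp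
      rw [e3]
      linarith
  · have := hA.α_pos 2 (by omega)
    positivity
  · intro t
    have := hA.α_pos (t + 1 + 2) (by omega)
    have := hA.α_anti (t + 2) (by omega)
    exact one_div_le_one_div_of_le (by positivity) (by
      rw [show t + 1 + 2 = t + 2 + 1 by ring]; linarith)
  · intro t
    exact sum_nonneg fun i _ => by positivity
  · intro t ht
    calc _ ≤ ∑ i : Fin n, (2 * R) ^ 2 := sum_le_sum fun i _ => ?_
      _ = _ := by rw [sum_const, card_univ, Fintype.card_fin, nsmul_eq_mul]; ring
    have := hP.norm_sub_le (h.x_mem i (show 1 ≤ t + 1 by omega)) (feasible_mem hy (t := t) (by omega))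
    gcongr
  · intro t ht
    calc _ ≤ ∑ i : Fin n, (‖s.x i (t + 2) - y (t + 1)‖ ^ 2 +
          4 * R * ‖y (t + 2) - y (t + 1)‖) := sum_le_sum fun i _ => ?_
      _ = _ := by simp [sum_add_distrib]; ring
    have h2 := hP.norm_sub_le (h.x_mem i (show 1 ≤ t + 2 by omega)) (feasible_mem hy (t := t) (by omega))
    have h3 := hP.norm_sub_le (h.x_mem i (show 1 ≤ t + 2 by omega)) (feasible_mem hy (t := t + 1) (by omega))
    have h4 := norm_sub_le_norm_sub_add_norm_sub (s.x i (t + 2)) (y (t + 1)) (y (t + 2))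
    rw [norm_sub_rev (y (t + 1))] at h4
    have h5 := norm_nonneg (s.x i (t + 2) - y (t + 1))
    have h6 := norm_nonneg (s.x i (t + 2) - y (t + 2))
    have h7 := norm_nonneg (y (t + 2) - y (t + 1))
    simp only [add_assoc, one_add_one_eq_two] at h3 ⊢
    nlinarith [mul_le_mul_of_nonneg_right h4 (add_nonneg h5 h6),
      mul_le_mul_of_nonneg_left (add_le_add h2 h3) h7]

theorem Admissible.sum_threshold_le (hA : Admissible α β γ τ) (T : ℕ) :
    ∑ t ∈ range T, τ (t + 1) / α (t + 2) ≤ (∑ t ∈ range T, τ (t + 1)) / α (T + 1) := by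
  rw [sum_div]
  refine sum_le_sum fun t ht => ?_
  rw [mem_range] at ht
  exact div_le_div_of_nonneg_left (hA.τ_nonneg _ (by omega)) (hA.α_pos _ (by omega))
    (hA.antitone (by omega) (by omega))

/-- Young's inequality `k v ≤ v² / (2α) + k² α / 2`. The squares are exactly those that the
projection inequality supplies with a negative sign. -/
theorem Trajectory.mul_sum_residual_le (s : Trajectory n p m) (hα : ∀ t ≥ 1, 0 < α t)
    (k : ℝ) (T : ℕ) :
    k * ∑ t ∈ range T, s.residual (t + 1) ≤ ∑ t ∈ range T, 1 / (2 * α (t + 2)) *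
      ∑ i, ‖s.x i (t + 2) - s.z i (t + 2)‖ ^ 2 +
      n * (k ^ 2 / 2) * ∑ t ∈ range T, α (t + 2) := by
  rw [mul_sum, mul_sum, ← sum_add_distrib]
  refine sum_le_sum fun t _ => ?_
  have hα := hα (t + 2) (by omega)
  have h1 : ∀ i, k * ‖s.x i (t + 2) - s.z i (t + 2)‖ ≤ 1 / (2 * α (t + 2)) *
      ‖s.x i (t + 2) - s.z i (t + 2)‖ ^ 2 + k ^ 2 / 2 * α (t + 2) := by
    intro i
    generalize ‖s.x i (t + 2) - s.z i (t + 2)‖ = v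
    have h2 : 0 ≤ 1 / (2 * α (t + 2)) * (v - k * α (t + 2)) ^ 2 := by positivity
    have h3 : 1 / (2 * α (t + 2)) * (v - k * α (t + 2)) ^ 2 =
        1 / (2 * α (t + 2)) * v ^ 2 + k ^ 2 / 2 * α (t + 2) -
        k * v := by
      field_simp
      ring
    linarith
  have h4 := sum_le_sum fun i (_ : i ∈ univ) => h1 i
  rw [← mul_sum, sum_add_distrib, ← mul_sum, sum_const, card_univ, Fintype.card_fin,
    nsmul_eq_mul] at h4
  simp only [Trajectory.residual, add_assoc, one_add_one_eq_two]
  linarith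

theorem Generated.sum_network_step_le (h : Generated X f g F₂ W α β γ τ s)
    (hP : ConvexProblem X f g R F₁ F₂) (hW : MixingNetwork G W w B)
    (hA : Admissible α β γ τ) (hF₂ : 0 ≤ F₂) {c r : ℝ} (hr : 0 ≤ r)
    (hci : ∀ i, ‖ones (Fin (m i))‖ ≤ c) {T : ℕ} {y : ℕ → Vec p} (hy : y ∈ feasibleSeqs X g T) :
    ∑ t ∈ range T, ∑ i, (f i (t + 1) (s.x i (t + 1)) - f i (t + 1) (y (t + 1))) +
      r * ∑ t ∈ range T, ∑ i, ‖posVec (g i (t + 1) (s.x i (t + 1)))‖ ≤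
      ∑ t ∈ range T, 1 / (2 * α (t + 2)) * (∑ i, ‖s.x i (t + 1) - y (t + 1)‖ ^ 2 -
        ∑ i, ‖s.x i (t + 2) - y (t + 1)‖ ^ 2) +
      n * (2 * R) * ∑ t ∈ range T, τ (t + 1) / α (t + 2) -
      ∑ t ∈ range T, 1 / (2 * α (t + 2)) * ∑ i, ‖s.x i (t + 2) - s.z i (t + 2)‖ ^ 2 +
      (1 + r * c) * F₂ * (∑ t ∈ range T, s.residual (t + 1) + n * ∑ t ∈ range T, τ (t + 1) +
        2 * ∑ t ∈ range T, s.disagreement (t + 1)) +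
      ∑ t ∈ range T, ∑ i, inner ℝ (r • ones (Fin (m i)) - s.q i (t + 1))
        (s.dualStep g i (t + 1)) := by
  have h1 := sum_le_sum fun t (ht : t ∈ range T) =>
    h.network_step_le hP hW hA hF₂ hr hci (show 1 ≤ t + 1 by omega)
      (feasible_mem hy (t := t) (mem_range.1 ht)) (feasible_le hy (t := t) (mem_range.1 ht))
  simp only [sum_add_distrib, sum_sub_distrib (s := range T), ← mul_sum] at h1
  exact h1

theorem weighted_sum_le {a₁ a₂ a₃ a₄ a₅ a₆ a₇ b₁ b₂ b₃ b₄ b₅ b₆ b₇ : ℝ} (ha₁ : 0 ≤ a₁)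
    (ha₂ : 0 ≤ a₂) (ha₃ : 0 ≤ a₃) (ha₄ : 0 ≤ a₄) (ha₅ : 0 ≤ a₅) (ha₆ : 0 ≤ a₆) (ha₇ : 0 ≤ a₇)
    (hb₁ : 0 ≤ b₁) (hb₂ : 0 ≤ b₂) (hb₃ : 0 ≤ b₃) (hb₄ : 0 ≤ b₄) (hb₅ : 0 ≤ b₅) (hb₆ : 0 ≤ b₆)
    (hb₇ : 0 ≤ b₇) :
    a₁ * b₁ + a₂ * b₂ + a₃ * b₃ + a₄ * b₄ + a₅ * b₅ + a₆ * b₆ + a₇ * b₇ ≤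
      (a₁ + a₂ + a₃ + a₄ + a₅ + a₆ + a₇) * (b₁ + b₂ + b₃ + b₄ + b₅ + b₆ + b₇) := by
  simp only [mul_add]
  gcongr <;> linarith

/-- Eliminates the disagreement `V` in favour of `E` and `Ψ`. What remains of `E` has coefficient
`(1 + r) k` with `k` free of `r`, ready for Young's inequality. -/
theorem absorb_disagreement {c F d k₁ r E Ψ V N : ℝ} (hc : 0 ≤ c) (hF : 0 ≤ F) (hd : 0 ≤ d)
    (hr : 0 ≤ r) (hE : 0 ≤ E) (hΨ : 0 ≤ Ψ) (hN : 0 ≤ N) (hk₁ : 0 ≤ k₁) (hV : V ≤ k₁ * (1 + E + Ψ)) :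
    (1 + r * c) * F * (E + N * Ψ + 2 * V) + (1 + r) * d * V ≤
      ((1 + c) * F * (1 + N) + (2 * ((1 + c) * F) + d) * k₁) * ((1 + r) * (1 + Ψ)) +
        (1 + r) * ((1 + c) * F * (1 + N) + (2 * ((1 + c) * F) + d) * k₁) * E := by
  have h0 : (1 + r * c) * F ≤ (1 + r) * ((1 + c) * F) := by
    have h1 : 0 ≤ (r + c) * F := by positivity
    linarith
  have h2 := mul_le_mul_of_nonneg_right h0 (show 0 ≤ E + N * Ψ by positivity)
  have h3 : (2 * ((1 + r * c) * F) + (1 + r) * d) * V ≤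
      (1 + r) * (2 * ((1 + c) * F) + d) * (k₁ * (1 + E + Ψ)) :=
    (mul_le_mul_of_nonneg_left hV (by positivity)).trans (mul_le_mul_of_nonneg_right
      (by linarith) (by positivity))
  have h4 : 0 ≤ (1 + r) * ((1 + c) * F) * (1 + N + Ψ + N * E) := by positivity
  linarith

/-- The basic inequality behind both the regret and the constraint violation bound. -/
theorem exists_network_bound (hn : 0 < n) (m : Fin n → ℕ) (hR : 0 ≤ R)
    (hF₂ : 0 ≤ F₂) (hw : 0 < w) (B : ℕ) {d : ℝ} (hd : 0 ≤ d) :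
    ∃ K : ℝ, 0 ≤ K ∧ ∀ (p : ℕ) (X : Set (Vec p)) (f : Fin n → ℕ → Vec p → ℝ)
      (g : (i : Fin n) → ℕ → Vec p → Vec (m i)) (G : ℕ → Digraph (Fin n))
      (W : ℕ → Matrix (Fin n) (Fin n) ℝ) (s : Trajectory n p m) (α β γ τ : ℕ → ℝ),
      ConvexProblem X f g R F₁ F₂ → MixingNetwork G W w B → Generated X f g F₂ W α β γ τ s →
      Admissible α β γ τ → ∀ T : ℕ, 1 ≤ T → ∀ y ∈ feasibleSeqs X g T, ∀ r : ℝ, 0 ≤ r →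
      ∑ t ∈ range T, ∑ i, (f i (t + 1) (s.x i (t + 1)) - f i (t + 1) (y (t + 1))) +
        r * ∑ t ∈ range T, ∑ i, ‖posVec (g i (t + 1) (s.x i (t + 1)))‖ +
        (1 + r) * d * ∑ t ∈ range T, s.disagreement (t + 1) ≤
      K * (1 / α (T + 1) + 1 / α T * pathLength y T +
        (∑ t ∈ range T, τ (t + 1)) / α (T + 1) + (1 + r) * (1 + ∑ t ∈ range T, τ (t + 1)) +
        (1 + r) ^ 2 * ∑ t ∈ range T, α (t + 2) +
        r ^ 2 * (1 / γ 1 + ∑ t ∈ range T, β (t + 2)) + ∑ t ∈ range T, γ (t + 2)) := by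
  set c : ℝ := ∑ i, ‖ones (Fin (m i))‖ with hc
  have hc0 : 0 ≤ c := sum_nonneg fun _ _ => norm_nonneg _
  have hci : ∀ i, ‖ones (Fin (m i))‖ ≤ c := fun i =>
    single_le_sum (f := fun i => ‖ones (Fin (m i))‖) (fun _ _ => norm_nonneg _) (mem_univ i)
  set k₀ : ℝ := (1 + c) * F₂ with hk₀
  set k₁ : ℝ := (n * B : ℕ) * (2 * n * R + 2 + 2 * n) / w ^ (n * B) with hk₁
  set k : ℝ := k₀ * (1 + n) + (2 * k₀ + d) * k₁ with hk
  set M : ℝ := F₁ + F₂ * (2 * R) with hM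
  have hk₀0 : 0 ≤ k₀ := by positivity
  have hk₁0 : 0 ≤ k₁ := by positivity
  have hk0 : 0 ≤ k := by positivity
  refine ⟨n * (2 * R ^ 2) + n * (2 * R) + n * (2 * R) + k + n * (k ^ 2 / 2) +
    n * (c ^ 2 / 2) + n * (2 * M ^ 2), by positivity, ?_⟩
  intro p X f g G W s α β γ τ hP hW h hA T hT y hy r hr
  set E := ∑ t ∈ range T, s.residual (t + 1) with hE
  set Ψ := ∑ t ∈ range T, τ (t + 1) with hΨ
  set V := ∑ t ∈ range T, s.disagreement (t + 1) with hV
  have hE0 : 0 ≤ E := sum_nonneg fun _ _ => s.residual_nonneg _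
  have hΨ0 : 0 ≤ Ψ := sum_nonneg fun _ _ => hA.τ_nonneg _ (by omega)
  have hV0 : 0 ≤ V := sum_nonneg fun _ _ => s.disagreement_nonneg _
  have hVE : V ≤ k₁ * (1 + E + Ψ) := h.sum_disagreement_le_mul hP hn hw hW hA hR T
  have hdual := h.sum_dual_le hP hA hr hci hM.symm T
  have htel := h.sum_telescope_le hP hA hR hT hy
  have htrig := hA.sum_threshold_le T
  -- The coefficient that `E` has after `absorb_disagreement`; its square is the origin of `(1 + r)
  -- ^ 2 * ∑ α`.
  have hres := s.mul_sum_residual_le hA.α_pos ((1 + r) * k) T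
  have hmain := h.sum_network_step_le hP hW hA hF₂ hr hci hy
  rw [mul_pow] at hres
  have hfin := absorb_disagreement (N := n) hc0 hF₂ hd hr hE0 hΨ0 (Nat.cast_nonneg n) hk₁0 hVE
  have t1 : 0 ≤ 1 / α (T + 1) := one_div_nonneg.2 (hA.α_pos _ (by omega)).le
  have t2 : 0 ≤ 1 / α T * pathLength y T :=
    mul_nonneg (one_div_nonneg.2 (hA.α_pos _ hT).le) (sum_nonneg fun _ _ => norm_nonneg _)
  have t3 : 0 ≤ Ψ / α (T + 1) := div_nonneg hΨ0 (hA.α_pos _ (by omega)).le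
  have t4 : 0 ≤ (1 + r) * (1 + Ψ) := by positivity
  have t5 : 0 ≤ (1 + r) ^ 2 * ∑ t ∈ range T, α (t + 2) :=
    mul_nonneg (sq_nonneg _) (sum_nonneg fun t _ => (hA.α_pos (t + 2) (by omega)).le)
  have t6 : 0 ≤ r ^ 2 * (1 / γ 1 + ∑ t ∈ range T, β (t + 2)) :=
    mul_nonneg (sq_nonneg _) (add_nonneg (one_div_nonneg.2 (hA.γ_pos 1 le_rfl).le)
      (sum_nonneg fun t _ => (hA.β_pos (t + 2) (by omega)).le))
  have t7 : 0 ≤ ∑ t ∈ range T, γ (t + 2) :=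
    sum_nonneg fun t _ => (hA.γ_pos (t + 2) (by omega)).le
  have htrig' := mul_le_mul_of_nonneg_left htrig (show 0 ≤ n * (2 * R) by positivity)
  refine le_trans ?_ (weighted_sum_le (by positivity) (by positivity)
    (by positivity) hk0 (by positivity) (by positivity) (by positivity) t1 t2 t3 t4 t5 t6 t7)
  linarith

end Bound

/-! ### Growth of the step sizes and of `Ψ` -/

section Rates

theorem sum_Icc_one_eq {M : Type*} [AddCommMonoid M] (F : ℕ → M) (T : ℕ) :
    ∑ t ∈ Icc 1 T, F t = ∑ t ∈ range T, F (t + 1) := by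
  induction T with
  | zero => simp
  | succ T ih => rw [sum_Icc_succ_top (by omega), ih, sum_range_succ]

/-- Bernoulli's inequality for `(1 - 1 / (T + 1)) ^ (1 - a)` shows that the right side grows by at
least the new summand. -/
theorem sum_one_div_rpow_le {a : ℝ} (ha0 : 0 ≤ a) (ha1 : a < 1) (T : ℕ) :
    ∑ t ∈ range T, 1 / ((t + 1 : ℕ) : ℝ) ^ a ≤ (T : ℝ) ^ (1 - a) / (1 - a) := by
  have hb : 0 < 1 - a := sub_pos.2 ha1
  induction T with
  | zero => simp [Real.zero_rpow hb.ne']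
  | succ T ih =>
    rw [sum_range_succ]
    refine (add_le_add_left ih _).trans ?_
    have hT : (0 : ℝ) < (T + 1 : ℕ) := by positivity
    rw [div_add' _ _ _ hb.ne']
    refine div_le_div_of_nonneg_right ?_ hb.le
    have h1 := rpow_one_add_le_one_add_mul_self
      (show -1 ≤ -(1 / ((T + 1 : ℕ) : ℝ)) by
        rw [neg_le_neg_iff, div_le_one hT]; push_cast; linarith [Nat.cast_nonneg (α := ℝ) T])
      hb.le (by linarith)
    have h2 : (T : ℝ) = ((T + 1 : ℕ) : ℝ) * (1 + -(1 / ((T + 1 : ℕ) : ℝ))) := by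
      field_simp; push_cast; ring
    have h0 : 0 ≤ 1 + -(1 / ((T + 1 : ℕ) : ℝ)) := by
      by_contra! hneg
      have := mul_neg_of_pos_of_neg hT hneg
      rw [← h2] at this
      exact absurd (Nat.cast_nonneg (α := ℝ) T) (not_le.2 this)
    have h3 : (T : ℝ) ^ (1 - a) ≤ ((T + 1 : ℕ) : ℝ) ^ (1 - a) *
        (1 + (1 - a) * -(1 / ((T + 1 : ℕ) : ℝ))) := by
      calc (T : ℝ) ^ (1 - a) = ((T + 1 : ℕ) : ℝ) ^ (1 - a) *
            (1 + -(1 / ((T + 1 : ℕ) : ℝ))) ^ (1 - a) := by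
            rw [← Real.mul_rpow hT.le h0, ← h2]
        _ ≤ _ := mul_le_mul_of_nonneg_left h1 (by positivity)
    have h4 : ((T + 1 : ℕ) : ℝ) ^ (1 - a) * (1 / ((T + 1 : ℕ) : ℝ)) =
        1 / ((T + 1 : ℕ) : ℝ) ^ a := by
      rw [Real.rpow_sub hT, Real.rpow_one]
      field_simp
    have h5 : ((T + 1 : ℕ) : ℝ) ^ (1 - a) * (1 + (1 - a) * -(1 / ((T + 1 : ℕ) : ℝ))) =
        ((T + 1 : ℕ) : ℝ) ^ (1 - a) - 1 / ((T + 1 : ℕ) : ℝ) ^ a * (1 - a) := by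
      rw [← h4]; ring
    linarith

theorem one_div_rpow_anti {a : ℝ} (ha : 0 ≤ a) {s t : ℕ} (hs : 1 ≤ s) (hst : s ≤ t) :
    1 / (t : ℝ) ^ a ≤ 1 / (s : ℝ) ^ a := by
  have : (0 : ℝ) < s := by exact_mod_cast hs
  gcongr

variable {θ κ : ℝ}

theorem psiSeq_eq (τ : ℕ → ℝ) (T : ℕ) : psiSeq τ T = ∑ t ∈ range T, τ (t + 1) :=
  sum_Icc_one_eq τ T

theorem tauSeq_pos {t : ℕ} (ht : 1 ≤ t) : 0 < tauSeq θ t := by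
  have : (0 : ℝ) < t := by exact_mod_cast ht
  unfold tauSeq; positivity

theorem tauSeq_one : tauSeq θ 1 = 1 := by simp [tauSeq]

theorem one_le_psiSeq {T : ℕ} (hT : 1 ≤ T) : 1 ≤ psiSeq (tauSeq θ) T := by
  rw [psiSeq_eq, ← tauSeq_one (θ := θ)]
  exact single_le_sum (f := fun t => tauSeq θ (t + 1))
    (fun t _ => (tauSeq_pos (by omega)).le) (mem_range.2 hT)

theorem psiSeq_mono {S T : ℕ} (h : S ≤ T) : psiSeq (tauSeq θ) S ≤ psiSeq (tauSeq θ) T := by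
  rw [psiSeq_eq, psiSeq_eq]
  exact sum_le_sum_of_subset_of_nonneg (range_mono h) fun t _ _ => (tauSeq_pos (by omega)).le

theorem psiSeq_le (hθ : 0 ≤ θ) (T : ℕ) : psiSeq (tauSeq θ) T ≤ T := by
  rw [psiSeq_eq]
  calc _ ≤ ∑ t ∈ range T, (1 : ℝ) := sum_le_sum fun t _ => by
        rw [← tauSeq_one (θ := θ)]
        exact one_div_rpow_anti hθ le_rfl (by omega)
    _ = T := by simp

theorem mul_tauSeq_le_psiSeq (hθ : 0 ≤ θ) {T S : ℕ} (h : T ≤ S) :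
    T * tauSeq θ S ≤ psiSeq (tauSeq θ) T := by
  rw [psiSeq_eq]
  calc _ = ∑ t ∈ range T, tauSeq θ S := by simp
    _ ≤ _ := sum_le_sum fun t ht => by
        rw [mem_range] at ht
        exact one_div_rpow_anti hθ (by omega) (by omega)

theorem alphaSeq_pos {t : ℕ} (ht : 1 ≤ t) : 0 < alphaSeq (tauSeq θ) t := by
  have h1 : (0 : ℝ) < t := by exact_mod_cast ht
  have h2 := one_le_psiSeq (θ := θ) ht
  exact Real.sqrt_pos.2 (by positivity)

/-- `Ψ_t / t` is the running mean of a nonincreasing sequence. -/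
theorem alphaSeq_anti (hθ : 0 ≤ θ) {t : ℕ} (ht : 1 ≤ t) :
    alphaSeq (tauSeq θ) (t + 1) ≤ alphaSeq (tauSeq θ) t := by
  have h1 : (0 : ℝ) < t := by exact_mod_cast ht
  refine Real.sqrt_le_sqrt ?_
  rw [div_le_div_iff₀ (by positivity) h1]
  have h2 := mul_tauSeq_le_psiSeq hθ (Nat.le_succ t)
  have h3 : psiSeq (tauSeq θ) (t + 1) = psiSeq (tauSeq θ) t + tauSeq θ (t + 1) := by
    rw [psiSeq_eq, psiSeq_eq, sum_range_succ]
  rw [h3]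
  push_cast
  simp only [Nat.succ_eq_add_one] at h2
  linarith

theorem betaSeq_mul_gammaSeq {t : ℕ} (ht : 1 ≤ t) : betaSeq κ t * gammaSeq κ t = 1 / t := by
  have h1 : (0 : ℝ) < t := by exact_mod_cast ht
  rw [betaSeq, gammaSeq, div_mul_div_comm, ← Real.rpow_add h1]
  simp

theorem admissible_power (hθ : 0 ≤ θ) (hκ0 : 0 ≤ κ) :
    Admissible (alphaSeq (tauSeq θ)) (betaSeq κ) (gammaSeq κ) (tauSeq θ) where
  α_pos t ht := alphaSeq_pos ht
  α_anti t ht := alphaSeq_anti hθ ht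
  β_pos t ht := by
    have h1 : (0 : ℝ) < t := by exact_mod_cast ht
    unfold betaSeq; positivity
  β_anti t ht := one_div_rpow_anti hκ0 ht (by omega)
  γ_pos t ht := by
    have h1 : (0 : ℝ) < t := by exact_mod_cast ht
    unfold gammaSeq; positivity
  βγ_le t ht := by
    have h1 : (1 : ℝ) ≤ t := by exact_mod_cast ht
    rw [betaSeq_mul_gammaSeq ht]
    exact div_le_one_of_le₀ h1 (by positivity)
  -- The left side equals `t (t+1)^(-κ)`, which is at most `t · t^(-κ)`.
  γ_drift t ht := by
    have h1 : (0 : ℝ) < t := by exact_mod_cast ht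
    have h2 : (0 : ℝ) < (t + 1 : ℕ) := by positivity
    have h3 : ∀ s : ℕ, 0 < (s : ℝ) → (s : ℝ) ^ (1 - κ) = s * (1 / (s : ℝ) ^ κ) := by
      intro s hs
      rw [Real.rpow_sub hs, Real.rpow_one, mul_one_div]
    simp only [gammaSeq, betaSeq, one_div_one_div]
    rw [h3 _ h1, h3 _ h2]
    have h4 := mul_le_mul_of_nonneg_left
      (one_div_rpow_anti hκ0 (s := t) (t := t + 1) ht (by omega)) h1.le
    push_cast at h4 ⊢
    linarith
  τ_nonneg t ht := (tauSeq_pos ht).le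

theorem one_div_alphaSeq (t : ℕ) :
    1 / alphaSeq (tauSeq θ) t = √((t : ℝ) / psiSeq (tauSeq θ) t) := by
  rw [alphaSeq, one_div, ← Real.sqrt_inv, inv_div]

theorem one_div_alphaSeq_succ_le {T : ℕ} (hT : 1 ≤ T) :
    1 / alphaSeq (tauSeq θ) (T + 1) ≤ 2 * √((T : ℝ) / psiSeq (tauSeq θ) T) := by
  have h1 : (1 : ℝ) ≤ T := by exact_mod_cast hT
  have h2 := one_le_psiSeq (θ := θ) hT
  have h3 := psiSeq_mono (θ := θ) (Nat.le_succ T)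
  rw [one_div_alphaSeq]
  calc √(((T + 1 : ℕ) : ℝ) / psiSeq (tauSeq θ) (T + 1)) ≤ √(2 ^ 2 * (T / psiSeq (tauSeq θ) T)) := by
        refine Real.sqrt_le_sqrt ?_
        rw [← mul_div_assoc]
        push_cast
        gcongr
        · linarith
    _ = _ := by rw [Real.sqrt_mul (by norm_num), Real.sqrt_sq zero_le_two]

theorem sqrt_div_psiSeq_le {T : ℕ} (hT : 1 ≤ T) :
    √((T : ℝ) / psiSeq (tauSeq θ) T) ≤ √((T : ℝ) * psiSeq (tauSeq θ) T) := by
  have h2 := one_le_psiSeq (θ := θ) hT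
  refine Real.sqrt_le_sqrt ?_
  rw [div_le_iff₀ (by positivity), mul_assoc]
  exact le_mul_of_one_le_right (Nat.cast_nonneg _) (one_le_mul_of_one_le_of_one_le h2 h2)

theorem psiSeq_mul_sqrt {T : ℕ} (hT : 1 ≤ T) :
    psiSeq (tauSeq θ) T * √((T : ℝ) / psiSeq (tauSeq θ) T) =
      √((T : ℝ) * psiSeq (tauSeq θ) T) := by
  have h2 := one_le_psiSeq (θ := θ) hT
  have h3 : psiSeq (tauSeq θ) T = √(psiSeq (tauSeq θ) T ^ 2) :=
    (Real.sqrt_sq (by positivity)).symm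
  nth_rw 1 [h3]
  rw [← Real.sqrt_mul (by positivity)]
  congr 1
  field_simp

/-- Freezes `Ψ` at its largest value `Ψ_T` and sums `1 / √t`. -/
theorem sum_alphaSeq_le (hθ : 0 ≤ θ) (T : ℕ) :
    ∑ t ∈ range T, alphaSeq (tauSeq θ) (t + 2) ≤ 2 * √((T : ℝ) * psiSeq (tauSeq θ) T) := by
  calc ∑ t ∈ range T, alphaSeq (tauSeq θ) (t + 2) ≤
      ∑ t ∈ range T, √(psiSeq (tauSeq θ) T) * (1 / ((t + 1 : ℕ) : ℝ) ^ (1 / 2 : ℝ)) := by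
        refine sum_le_sum fun t ht => ?_
        rw [mem_range] at ht
        refine (alphaSeq_anti hθ (show 1 ≤ t + 1 by omega)).trans ?_
        rw [alphaSeq, Real.sqrt_div' _ (Nat.cast_nonneg _), ← Real.sqrt_eq_rpow, mul_one_div]
        gcongr
        exact psiSeq_mono ht
    _ ≤ √(psiSeq (tauSeq θ) T) * ((T : ℝ) ^ (1 - 1 / 2 : ℝ) / (1 - 1 / 2)) := by
        rw [← mul_sum]
        gcongr
        exact sum_one_div_rpow_le (by norm_num) (by norm_num) T
    _ = _ := by
        rw [Real.sqrt_mul (Nat.cast_nonneg _), Real.sqrt_eq_rpow (T : ℝ)]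
        norm_num
        ring

theorem sum_betaSeq_le (hκ0 : 0 ≤ κ) (hκ1 : κ < 1) (T : ℕ) :
    ∑ t ∈ range T, betaSeq κ (t + 2) ≤ (T : ℝ) ^ (1 - κ) / (1 - κ) :=
  (sum_le_sum fun t _ => one_div_rpow_anti hκ0 (show 1 ≤ t + 1 by omega) (by omega)).trans
    (sum_one_div_rpow_le hκ0 hκ1 T)

theorem sum_gammaSeq_le (hκ0 : 0 < κ) (hκ1 : κ ≤ 1) (T : ℕ) :
    ∑ t ∈ range T, gammaSeq κ (t + 2) ≤ (T : ℝ) ^ κ / κ := by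
  have := sum_betaSeq_le (κ := 1 - κ) (by linarith) (by linarith) T
  simpa [gammaSeq, betaSeq] using this

theorem one_le_sqrt_mul_psiSeq {T : ℕ} (hT : 1 ≤ T) :
    1 ≤ √((T : ℝ) * psiSeq (tauSeq θ) T) := by
  have h1 : (1 : ℝ) ≤ T := by exact_mod_cast hT
  rw [Real.one_le_sqrt]
  exact one_le_mul_of_one_le_of_one_le h1 (one_le_psiSeq hT)

theorem psiSeq_le_sqrt (hθ : 0 ≤ θ) {T : ℕ} (hT : 1 ≤ T) :
    psiSeq (tauSeq θ) T ≤ √((T : ℝ) * psiSeq (tauSeq θ) T) := by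
  have h1 := one_le_psiSeq (θ := θ) hT
  refine Real.le_sqrt_of_sq_le ?_
  rw [sq]
  exact mul_le_mul_of_nonneg_right (psiSeq_le hθ T) (by positivity)

theorem sqrt_mul_psiSeq_le (hθ : 0 ≤ θ) (T : ℕ) : √((T : ℝ) * psiSeq (tauSeq θ) T) ≤ T := by
  refine Real.sqrt_le_iff.2 ⟨Nat.cast_nonneg _, ?_⟩
  rw [sq]
  exact mul_le_mul_of_nonneg_left (psiSeq_le hθ T) (Nat.cast_nonneg _)

theorem psiSeq_lower (hθ : 0 ≤ θ) {T : ℕ} (hT : 1 ≤ T) :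
    (T : ℝ) ^ (1 - θ) ≤ psiSeq (tauSeq θ) T := by
  have h1 : (0 : ℝ) < T := by exact_mod_cast hT
  refine le_trans (le_of_eq ?_) (mul_tauSeq_le_psiSeq hθ le_rfl)
  rw [tauSeq, Real.rpow_sub h1, Real.rpow_one, mul_one_div]

theorem exists_psiSeq_le (hθ : 1 < θ) :
    ∃ c, 1 ≤ c ∧ ∀ T : ℕ, psiSeq (tauSeq θ) T ≤ c := by
  have hs : Summable fun t : ℕ => tauSeq θ (t + 1) :=
    (summable_nat_add_iff 1).2 (Real.summable_one_div_nat_rpow.2 hθ)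
  have hle : ∀ T : ℕ, psiSeq (tauSeq θ) T ≤ ∑' t, tauSeq θ (t + 1) := fun T => by
    rw [psiSeq_eq]
    exact hs.sum_le_tsum _ fun t _ => (tauSeq_pos (by omega)).le
  exact ⟨_, (one_le_psiSeq le_rfl).trans (hle 1), hle⟩

theorem psiSeq_one_eq (T : ℕ) : psiSeq (tauSeq 1) T = (harmonic T : ℝ) := by
  rw [psiSeq_eq, harmonic]
  simp [tauSeq]

end Rates

/-! ### From the basic inequality to regret and violation -/

section Performance

variable {n p : ℕ} {m : Fin n → ℕ} {X : Set (Vec p)} {f : Fin n → ℕ → Vec p → ℝ}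
  {g : (i : Fin n) → ℕ → Vec p → Vec (m i)} {R F₁ F₂ w : ℝ} {B : ℕ} {G : ℕ → Digraph (Fin n)}
  {W : ℕ → Matrix (Fin n) (Fin n) ℝ} {α β γ τ : ℕ → ℝ} {s : Trajectory n p m}

/-- Regret evaluates every loss at every agent's decision, while the basic inequality only sees `f
j` at `x j`. The exchange costs `F₂ ‖x i - x j‖`, hence the disagreement term; `Generated.netCCV_le`
does the same for the constraints. -/
theorem Generated.netReg_le (h : Generated X f g F₂ W α β γ τ s)
    (hP : ConvexProblem X f g R F₁ F₂) (hn : 0 < n) (hF₂ : 0 ≤ F₂) (y : ℕ → Vec p) (T : ℕ) :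
    n * netReg f s.x y T ≤
      ∑ t ∈ range T, ∑ i, (f i (t + 1) (s.x i (t + 1)) - f i (t + 1) (y (t + 1))) +
        2 * F₂ * ∑ t ∈ range T, s.disagreement (t + 1) := by
  have hn0 : (0 : ℝ) < n := by exact_mod_cast hn
  have h1 : n * netReg f s.x y T = ∑ t ∈ range T, (∑ i, globalLoss f (t + 1) (s.x i (t + 1)) -
      ∑ i, f i (t + 1) (y (t + 1))) := by
    rw [netReg, sum_sub_distrib, sum_comm, sum_Icc_one_eq, sum_Icc_one_eq]
    simp only [globalLoss, ← mul_sum]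
    field_simp
  rw [h1, mul_sum, ← sum_add_distrib]
  refine sum_le_sum fun t _ => ?_
  have ht : 1 ≤ t + 1 := by omega
  have h2 : ∑ i, globalLoss f (t + 1) (s.x i (t + 1)) ≤
      ∑ j, f j (t + 1) (s.x j (t + 1)) + 2 * F₂ * s.disagreement (t + 1) := by
    simp only [globalLoss, ← mul_sum]
    rw [one_div, inv_mul_le_iff₀ hn0]
    calc ∑ i, ∑ j, f j (t + 1) (s.x i (t + 1)) ≤
        ∑ i, ∑ j, (f j (t + 1) (s.x j (t + 1)) + F₂ * ‖s.x i (t + 1) - s.x j (t + 1)‖) := by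
          refine sum_le_sum fun i _ => sum_le_sum fun j _ => ?_
          have := hP.loss_sub_le j ht (h.x_mem i ht) (h.x_mem j ht)
          linarith
      _ = n * ∑ j, f j (t + 1) (s.x j (t + 1)) +
          F₂ * ∑ i, ∑ j, ‖s.x i (t + 1) - s.x j (t + 1)‖ := by
          simp only [sum_add_distrib, ← mul_sum, sum_const, card_univ, Fintype.card_fin,
            nsmul_eq_mul]
      _ ≤ n * ∑ j, f j (t + 1) (s.x j (t + 1)) +
          F₂ * (2 * n * s.disagreement (t + 1)) := by
          gcongr
          exact s.sum_sum_norm_sub_le _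
      _ = _ := by ring
  rw [sum_sub_distrib]
  linarith

theorem norm_posVec_globalConstraint_le (t : ℕ) (x : Vec p) :
    ‖posVec (globalConstraint g t x)‖ ≤ ∑ i, ‖posVec (g i t x)‖ := by
  rw [EuclideanSpace.norm_eq]
  refine Real.sqrt_le_iff.2 ⟨sum_nonneg fun _ _ => norm_nonneg _, ?_⟩
  rw [Fintype.sum_sigma]
  calc _ = ∑ i, ‖posVec (g i t x)‖ ^ 2 :=
        sum_congr rfl fun i _ => by rw [EuclideanSpace.norm_sq_eq]; rfl
    _ ≤ _ := sum_sq_le_sq_sum_of_nonneg fun _ _ => norm_nonneg _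

theorem Generated.netCCV_le (h : Generated X f g F₂ W α β γ τ s)
    (hP : ConvexProblem X f g R F₁ F₂) (hn : 0 < n) (hF₂ : 0 ≤ F₂) {c : ℝ}
    (hc : ∀ i, ‖ones (Fin (m i))‖ ≤ c) (T : ℕ) :
    netCCV g s.x T ≤ ∑ t ∈ range T, ∑ i, ‖posVec (g i (t + 1) (s.x i (t + 1)))‖ +
      2 * (F₂ * c) * ∑ t ∈ range T, s.disagreement (t + 1) := by
  have hn0 : (0 : ℝ) < n := by exact_mod_cast hn
  have hc0 : 0 ≤ c := (norm_nonneg _).trans (hc ⟨0, hn⟩)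
  rw [netCCV, one_div, inv_mul_le_iff₀ hn0, sum_comm, sum_Icc_one_eq, mul_sum,
    ← sum_add_distrib, mul_sum]
  refine sum_le_sum fun t _ => ?_
  have ht : 1 ≤ t + 1 := by omega
  calc ∑ i, ‖posVec (globalConstraint g (t + 1) (s.x i (t + 1)))‖ ≤
      ∑ i, ∑ j, (‖posVec (g j (t + 1) (s.x j (t + 1)))‖ +
        F₂ * c * ‖s.x i (t + 1) - s.x j (t + 1)‖) := by
        refine sum_le_sum fun i _ => (norm_posVec_globalConstraint_le _ _).trans
          (sum_le_sum fun j _ => ?_)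
        have h1 := hP.posVec_constraint_le j ht (h.x_mem i ht) (h.x_mem j ht)
        have h2 := mul_le_mul_of_nonneg_left (hc j)
          (show 0 ≤ F₂ * ‖s.x i (t + 1) - s.x j (t + 1)‖ by positivity)
        linarith
    _ = n * ∑ j, ‖posVec (g j (t + 1) (s.x j (t + 1)))‖ +
        F₂ * c * ∑ i, ∑ j, ‖s.x i (t + 1) - s.x j (t + 1)‖ := by
        simp only [sum_add_distrib, ← mul_sum, sum_const, card_univ, Fintype.card_fin,
          nsmul_eq_mul]
    _ ≤ n * ∑ j, ‖posVec (g j (t + 1) (s.x j (t + 1)))‖ +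
        F₂ * c * (2 * n * s.disagreement (t + 1)) := by
        gcongr
        exact s.sum_sum_norm_sub_le _
    _ = _ := by ring

theorem pathLength_nonneg (y : ℕ → Vec p) (T : ℕ) : 0 ≤ pathLength y T :=
  sum_nonneg fun _ _ => norm_nonneg _

/-- `exists_network_bound` for the power-law parameters of the algorithm. -/
theorem exists_power_bound (hn : 0 < n) (m : Fin n → ℕ) (hR : 0 ≤ R) (hF₂ : 0 ≤ F₂)
    (hw : 0 < w) (B : ℕ) {κ θ : ℝ} (hκ0 : 0 < κ) (hκ1 : κ < 1) (hθ : 0 ≤ θ) {d : ℝ}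
    (hd : 0 ≤ d) :
    ∃ K : ℝ, 0 ≤ K ∧ ∀ (p : ℕ) (X : Set (Vec p)) (f : Fin n → ℕ → Vec p → ℝ)
      (g : (i : Fin n) → ℕ → Vec p → Vec (m i)) (G : ℕ → Digraph (Fin n))
      (W : ℕ → Matrix (Fin n) (Fin n) ℝ) (s : Trajectory n p m),
      ConvexProblem X f g R F₁ F₂ → MixingNetwork G W w B →
      Generated X f g F₂ W (alphaSeq (tauSeq θ)) (betaSeq κ) (gammaSeq κ) (tauSeq θ) s →
      ∀ T : ℕ, 1 ≤ T → ∀ y ∈ feasibleSeqs X g T, ∀ r : ℝ, 0 ≤ r →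
      ∑ t ∈ range T, ∑ i, (f i (t + 1) (s.x i (t + 1)) - f i (t + 1) (y (t + 1))) +
        r * ∑ t ∈ range T, ∑ i, ‖posVec (g i (t + 1) (s.x i (t + 1)))‖ +
        (1 + r) * d * ∑ t ∈ range T, s.disagreement (t + 1) ≤
      K * ((T : ℝ) ^ κ + √(T * psiSeq (tauSeq θ) T) +
        √(T / psiSeq (tauSeq θ) T) * pathLength y T +
        r ^ 2 * ((T : ℝ) ^ (1 - κ) + √(T * psiSeq (tauSeq θ) T))) := by
  obtain ⟨K, hK, hbound⟩ := exists_network_bound (F₁ := F₁) hn m hR hF₂ hw B hd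
  have hκ' : 0 < 1 - κ := by linarith
  -- The terms free of `r` contribute `2 + 2 + 4 + 4 = 12` times `√(T Ψ)`: from `1 / α`, `Ψ / α`,
  -- `(1 + r)(1 + Ψ)` and `(1 + r)² ∑ α`. The other two summands come from `∑ γ` and `∑ β`.
  refine ⟨K * (12 + 1 / κ + 1 / (1 - κ)), by positivity, ?_⟩
  intro p X f g G W s hP hW h T hT y hy r hr
  refine (hbound p X f g G W s _ _ _ _ hP hW h (admissible_power hθ hκ0.le) T hT y hy r
    hr).trans ?_
  rw [mul_assoc K]
  refine mul_le_mul_of_nonneg_left ?_ hK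
  rw [← psiSeq_eq]
  have hT1 : (1 : ℝ) ≤ T := by exact_mod_cast hT
  have h1 := one_div_alphaSeq_succ_le (θ := θ) hT
  have h2 := sqrt_div_psiSeq_le (θ := θ) hT
  have h3 := psiSeq_mul_sqrt (θ := θ) hT
  have h4 := sum_alphaSeq_le hθ T
  have h5 := sum_betaSeq_le hκ0.le hκ1 T
  have h6 := sum_gammaSeq_le hκ0 hκ1.le T
  have h7 := one_le_sqrt_mul_psiSeq (θ := θ) hT
  have h8 := psiSeq_le_sqrt hθ hT
  have h9 : (1 : ℝ) ≤ (T : ℝ) ^ (1 - κ) := Real.one_le_rpow hT1 hκ'.le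
  have h10 : (0 : ℝ) ≤ (T : ℝ) ^ κ := by positivity
  have h11 := one_le_psiSeq (θ := θ) hT
  have h12 : 1 / gammaSeq κ 1 = 1 := by simp [gammaSeq]
  have hPL := pathLength_nonneg y T
  rw [h12, div_eq_mul_one_div (psiSeq (tauSeq θ) T), one_div_alphaSeq T]
  have e3 : psiSeq (tauSeq θ) T * (1 / alphaSeq (tauSeq θ) (T + 1)) ≤
      2 * √(T * psiSeq (tauSeq θ) T) := by
    rw [← h3]
    have := mul_le_mul_of_nonneg_left h1 (zero_le_one.trans h11)
    linarith
  have e1 := h1.trans (mul_le_mul_of_nonneg_left h2 zero_le_two)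
  have hq0 : 0 ≤ √(T / psiSeq (tauSeq θ) T) * pathLength y T :=
    mul_nonneg (Real.sqrt_nonneg _) hPL
  generalize √(T * psiSeq (tauSeq θ) T) = S at *
  generalize √(T / psiSeq (tauSeq θ) T) * pathLength y T = Q at *
  generalize psiSeq (tauSeq θ) T = Ψ at *
  generalize ∑ t ∈ range T, alphaSeq (tauSeq θ) (t + 2) = sa at *
  generalize ∑ t ∈ range T, betaSeq κ (t + 2) = sb at *
  generalize ∑ t ∈ range T, gammaSeq κ (t + 2) = sg at *
  generalize (T : ℝ) ^ (1 - κ) = A at *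
  generalize (T : ℝ) ^ κ = Z at *
  rw [div_eq_mul_one_div] at h5 h6
  have k1 : 0 < 1 / κ := by positivity
  have k2 : 0 < 1 / (1 - κ) := by positivity
  generalize 1 / κ = a at *
  generalize 1 / (1 - κ) = b at *
  have hr1 : 1 + r ≤ 2 * (1 + r ^ 2) := by nlinarith [sq_nonneg (r - 1)]
  have hr2 : (1 + r) ^ 2 ≤ 2 * (1 + r ^ 2) := by nlinarith [sq_nonneg (r - 1)]
  have f4 : (1 + r) * (1 + Ψ) ≤ 2 * (1 + r ^ 2) * (2 * S) :=
    mul_le_mul hr1 (by linarith) (by linarith) (by positivity)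
  have f5 : (1 + r) ^ 2 * sa ≤ 2 * (1 + r ^ 2) * (2 * S) :=
    (mul_le_mul_of_nonneg_left h4 (sq_nonneg _)).trans
      (mul_le_mul_of_nonneg_right hr2 (by linarith))
  have f6 : r ^ 2 * (1 + sb) ≤ r ^ 2 * (A * (1 + b)) :=
    mul_le_mul_of_nonneg_left (by linarith) (sq_nonneg _)
  have g1 : 0 ≤ (a + b) * (S + Q + r ^ 2 * S) := by
    have : 0 ≤ S := by linarith
    positivity
  have g2 : 0 ≤ r ^ 2 * A := by positivity
  have g3 : 0 ≤ r ^ 2 * S := mul_nonneg (sq_nonneg _) (by linarith)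
  have g4 : 0 ≤ b * Z := by positivity
  have g5 : 0 ≤ a * (r ^ 2 * A) := by positivity
  linarith

theorem exists_regret_bound (hn : 0 < n) (m : Fin n → ℕ) (hR : 0 ≤ R) (hF₂ : 0 ≤ F₂)
    (hw : 0 < w) (B : ℕ) {κ θ : ℝ} (hκ0 : 0 < κ) (hκ1 : κ < 1) (hθ : 0 ≤ θ) :
    ∃ K : ℝ, 0 ≤ K ∧ ∀ (p : ℕ) (X : Set (Vec p)) (f : Fin n → ℕ → Vec p → ℝ)
      (g : (i : Fin n) → ℕ → Vec p → Vec (m i)) (G : ℕ → Digraph (Fin n))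
      (W : ℕ → Matrix (Fin n) (Fin n) ℝ) (s : Trajectory n p m),
      ConvexProblem X f g R F₁ F₂ → MixingNetwork G W w B →
      Generated X f g F₂ W (alphaSeq (tauSeq θ)) (betaSeq κ) (gammaSeq κ) (tauSeq θ) s →
      ∀ T : ℕ, 1 ≤ T → ∀ y ∈ feasibleSeqs X g T,
      netReg f s.x y T ≤ K * ((T : ℝ) ^ κ + √(T * psiSeq (tauSeq θ) T) +
        √(T / psiSeq (tauSeq θ) T) * pathLength y T) := by
  obtain ⟨K, hK, hbound⟩ := exists_power_bound (F₁ := F₁) hn m hR hF₂ hw B hκ0 hκ1 hθ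
    (show 0 ≤ 2 * F₂ by positivity)
  have hn0 : (0 : ℝ) < n := by exact_mod_cast hn
  refine ⟨K / n, by positivity, ?_⟩
  intro p X f g G W s hP hW h T hT y hy
  have h1 := hbound p X f g G W s hP hW h T hT y hy 0 le_rfl
  have h2 := h.netReg_le hP hn hF₂ y T
  rw [div_mul_eq_mul_div, le_div_iff₀ hn0]
  linarith

/-- Choosing the multiplier that balances `T` against `r ^ 2 * A`. -/
theorem le_mul_sqrt_of_balance {v a T A : ℝ} (hT : 0 < T) (hA : 0 < A)
    (h : ∀ r, 0 < r → r ^ 2 * A = T → r * v ≤ a * T) : v ≤ a * √(T * A) := by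
  have hr0 : 0 < √(T / A) := Real.sqrt_pos.2 (by positivity)
  have hrT : √(T / A) * √(T * A) = T := by
    rw [← Real.sqrt_mul (by positivity)]
    have : T / A * (T * A) = T ^ 2 := by field_simp
    rw [this, Real.sqrt_sq hT.le]
  refine le_of_mul_le_mul_left ?_ hr0
  rw [mul_left_comm, hrT]
  exact h _ hr0 (by rw [Real.sq_sqrt (by positivity)]; field_simp)

theorem sqrt_mul_add_sqrt_le {T Ψ κ : ℝ} (hT : 0 < T) (hΨ : 0 ≤ Ψ) (hκ : κ < 2) :
    √(T * (T ^ (1 - κ) + √(T * Ψ))) ≤ T ^ (1 - κ / 2) + (T ^ 3 * Ψ) ^ (1 / 4 : ℝ) := by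
  have e1 : √(T * T ^ (1 - κ)) = T ^ (1 - κ / 2) := by
    rw [Real.sqrt_eq_rpow, ← Real.rpow_one_add' hT.le (by linarith), ← Real.rpow_mul hT.le]
    congr 1; ring
  have e2 : √(T * √(T * Ψ)) = (T ^ 3 * Ψ) ^ (1 / 4 : ℝ) := by
    have : T * √(T * Ψ) = √(T ^ 3 * Ψ) := by
      have e3 : T ^ 3 * Ψ = T ^ 2 * (T * Ψ) := by ring
      rw [e3, Real.sqrt_mul (sq_nonneg T), Real.sqrt_sq hT.le]
    rw [this, Real.sqrt_eq_rpow, Real.sqrt_eq_rpow, ← Real.rpow_mul (by positivity)]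
    norm_num
  rw [mul_add, ← e1, ← e2]
  have h1 : 0 ≤ T * T ^ (1 - κ) := by positivity
  have h2 : 0 ≤ T * √(T * Ψ) := by positivity
  refine Real.sqrt_le_iff.2 ⟨by positivity, ?_⟩
  rw [add_sq, Real.sq_sqrt h1, Real.sq_sqrt h2]
  have h3 : 0 ≤ 2 * √(T * T ^ (1 - κ)) * √(T * √(T * Ψ)) := by positivity
  linarith

/-- A static comparator has no path length, and loss differences are at least `-F₁`, so `r` ·
violation is at most a multiple of `T` once `r² A = T`. Dividing by this `r` gives `√(T A)`. -/
theorem exists_violation_bound (hn : 0 < n) (m : Fin n → ℕ) (hR : 0 ≤ R) (hF₁ : 0 ≤ F₁)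
    (hF₂ : 0 ≤ F₂) (hw : 0 < w) (B : ℕ) {κ θ : ℝ} (hκ0 : 0 < κ) (hκ1 : κ < 1) (hθ : 0 ≤ θ) :
    ∃ K : ℝ, 0 ≤ K ∧ ∀ (p : ℕ) (X : Set (Vec p)) (f : Fin n → ℕ → Vec p → ℝ)
      (g : (i : Fin n) → ℕ → Vec p → Vec (m i)) (G : ℕ → Digraph (Fin n))
      (W : ℕ → Matrix (Fin n) (Fin n) ℝ) (s : Trajectory n p m),
      ConvexProblem X f g R F₁ F₂ → MixingNetwork G W w B →
      Generated X f g F₂ W (alphaSeq (tauSeq θ)) (betaSeq κ) (gammaSeq κ) (tauSeq θ) s →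
      ∀ T : ℕ, 1 ≤ T → (feasibleStatic X g T).Nonempty →
      netCCV g s.x T ≤ K * ((T : ℝ) ^ (1 - κ / 2) +
        ((T : ℝ) ^ 3 * psiSeq (tauSeq θ) T) ^ (1 / 4 : ℝ)) := by
  set c : ℝ := ∑ i, ‖ones (Fin (m i))‖ with hc
  have hc0 : 0 ≤ c := sum_nonneg fun _ _ => norm_nonneg _
  have hci : ∀ i, ‖ones (Fin (m i))‖ ≤ c := fun i =>
    single_le_sum (f := fun i => ‖ones (Fin (m i))‖) (fun _ _ => norm_nonneg _) (mem_univ i)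
  obtain ⟨K, hK, hbound⟩ := exists_power_bound (F₁ := F₁) hn m hR hF₂ hw B hκ0 hκ1 hθ
    (show 0 ≤ 2 * (F₂ * c) by positivity)
  refine ⟨n * F₁ + 3 * K, by positivity, ?_⟩
  intro p X f g G W s hP hW h T hT ⟨y, hy⟩
  have hT1 : (1 : ℝ) ≤ T := by exact_mod_cast hT
  have hT0 : (0 : ℝ) < T := by linarith
  have hS1 := one_le_sqrt_mul_psiSeq (θ := θ) hT
  have hST := sqrt_mul_psiSeq_le hθ T
  have hsqrt := sqrt_mul_add_sqrt_le hT0 (zero_le_one.trans (one_le_psiSeq (θ := θ) hT))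
    (show κ < 2 by linarith)
  refine le_trans (le_mul_sqrt_of_balance hT0 (by positivity) ?_)
    (mul_le_mul_of_nonneg_left hsqrt (by positivity))
  intro r hr0 hrA
  have h1 := hbound p X f g G W s hP hW h T hT _ hy r hr0.le
  have h2 := mul_le_mul_of_nonneg_left (h.netCCV_le hP hn hF₂ hci T) hr0.le
  have hV0 : 0 ≤ 2 * (F₂ * c) * ∑ t ∈ range T, s.disagreement (t + 1) :=
    mul_nonneg (by positivity) (sum_nonneg fun _ _ => s.disagreement_nonneg _)
  have hpath : pathLength (fun _ => y) T = 0 := by simp [pathLength]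
  have hloss : -(n * F₁ * T) ≤
      ∑ t ∈ range T, ∑ i, (f i (t + 1) (s.x i (t + 1)) - f i (t + 1) y) := by
    calc -(n * F₁ * T) = ∑ t ∈ range T, ∑ i : Fin n, -F₁ := by simp; ring
      _ ≤ _ := sum_le_sum fun t ht => sum_le_sum fun i _ => by
          have ht' : 1 ≤ t + 1 := by omega
          exact (abs_le.1 (hP.loss_variation i _ ht' _ (h.x_mem i ht') y
            (feasible_mem hy (mem_range.1 ht)))).1
  have hTκ : (T : ℝ) ^ κ ≤ T := by
    simpa using Real.rpow_le_rpow_of_exponent_le hT1 hκ1.le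
  rw [hpath, hrA, mul_zero, add_zero] at h1
  have h5 : K * ((T : ℝ) ^ κ + √(T * psiSeq (tauSeq θ) T) + T) ≤ K * (3 * T) :=
    mul_le_mul_of_nonneg_left (by linarith) hK
  linarith

end Performance

/-! ### Translating bounds on `Ψ` into powers of `T` -/

section PowerRates

variable {T : ℕ} {Ψ c e : ℝ}

theorem sqrt_mul_le_rpow (hT : 1 ≤ T) (hc : 1 ≤ c) (h : Ψ ≤ c * (T : ℝ) ^ e) :
    √(T * Ψ) ≤ c * (T : ℝ) ^ ((1 + e) / 2) := by
  have hT0 : (0 : ℝ) < T := by exact_mod_cast hT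
  refine Real.sqrt_le_iff.2 ⟨by positivity, ?_⟩
  rw [mul_pow, ← Real.rpow_mul_natCast hT0.le, Nat.cast_ofNat, div_mul_cancel₀ _ two_ne_zero,
    Real.rpow_add hT0, Real.rpow_one]
  have h1 : (0 : ℝ) ≤ (T : ℝ) ^ e := by positivity
  calc T * Ψ ≤ T * (c * (T : ℝ) ^ e) := by gcongr
    _ = c * (T * (T : ℝ) ^ e) := by ring
    _ ≤ c ^ 2 * (T * (T : ℝ) ^ e) := by gcongr; nlinarith

theorem sqrt_div_le_rpow (hT : 1 ≤ T) (h : (T : ℝ) ^ e ≤ Ψ) :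
    √(T / Ψ) ≤ (T : ℝ) ^ ((1 - e) / 2) := by
  have hT0 : (0 : ℝ) < T := by exact_mod_cast hT
  have h1 : (0 : ℝ) < (T : ℝ) ^ e := by positivity
  refine Real.sqrt_le_iff.2 ⟨by positivity, ?_⟩
  rw [← Real.rpow_mul_natCast hT0.le, Nat.cast_ofNat, div_mul_cancel₀ _ two_ne_zero,
    Real.rpow_sub hT0, Real.rpow_one]
  gcongr

theorem rpow_quarter_le_rpow (hT : 1 ≤ T) (hc : 1 ≤ c) (hΨ : 0 ≤ Ψ)
    (h : Ψ ≤ c * (T : ℝ) ^ e) :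
    ((T : ℝ) ^ 3 * Ψ) ^ (1 / 4 : ℝ) ≤ c * (T : ℝ) ^ ((3 + e) / 4) := by
  have hT0 : (0 : ℝ) < T := by exact_mod_cast hT
  calc ((T : ℝ) ^ 3 * Ψ) ^ (1 / 4 : ℝ) ≤ ((T : ℝ) ^ 3 * (c * (T : ℝ) ^ e)) ^ (1 / 4 : ℝ) := by
        gcongr
    _ = (c * (T : ℝ) ^ (3 + e)) ^ (1 / 4 : ℝ) := by
        rw [Real.rpow_add hT0]
        norm_cast
        ring_nf
    _ = c ^ (1 / 4 : ℝ) * (T : ℝ) ^ ((3 + e) / 4) := by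
        rw [Real.mul_rpow (by positivity) (by positivity), ← Real.rpow_mul hT0.le]
        ring_nf
    _ ≤ c * (T : ℝ) ^ ((3 + e) / 4) := by
        gcongr
        simpa using Real.rpow_le_rpow_of_exponent_le hc (show (1 / 4 : ℝ) ≤ 1 by norm_num)

theorem rpow_add_mul_le_rpow_max (hT : 1 ≤ T) (hc : 1 ≤ c) (a b : ℝ) :
    (T : ℝ) ^ a + c * (T : ℝ) ^ b ≤ 2 * c * (T : ℝ) ^ max a b := by
  have hT1 : (1 : ℝ) ≤ T := by exact_mod_cast hT
  have h1 := Real.rpow_le_rpow_of_exponent_le hT1 (le_max_left a b)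
  have h2 := mul_le_mul_of_nonneg_left
    (Real.rpow_le_rpow_of_exponent_le hT1 (le_max_right a b)) (zero_le_one.trans hc)
  have h3 : (0 : ℝ) ≤ (T : ℝ) ^ max a b := by positivity
  have h4 := mul_le_mul_of_nonneg_right hc h3
  linarith

end PowerRates

/-- From `log 2 ≥ 1/2`, `1 + log T ≤ 3 log T`. At `T = 1` the logarithm vanishes and the bound
fails, so that horizon needs separate treatment. -/
theorem psiSeq_one_le_log {T : ℕ} (hT : 2 ≤ T) : psiSeq (tauSeq 1) T ≤ 3 * Real.log T := by
  rw [psiSeq_one_eq]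
  have h1 := harmonic_le_one_add_log T
  have h2 : Real.log 2 ≤ Real.log T := Real.log_le_log two_pos (by exact_mod_cast hT)
  have h3 := Real.log_two_gt_d9
  linarith

theorem log_le_psiSeq_one {T : ℕ} (hT : 1 ≤ T) : Real.log T ≤ psiSeq (tauSeq 1) T := by
  rw [psiSeq_one_eq]
  have hT0 : (0 : ℝ) < T := by exact_mod_cast hT
  exact (Real.log_le_log hT0 (by push_cast; linarith)).trans (log_add_one_le_harmonic T)

end EventTriggered

/-! ### The three regimes of `θ` -/

open EventTriggered in
theorem corollary1
    (n : ℕ) (hn : 0 < n) (m : Fin n → ℕ)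
    (R F₁ F₂ : ℝ) (hR : 0 < R) (hF₁ : 0 < F₁) (hF₂ : 0 < F₂)
    (w : ℝ) (hw0 : 0 < w) (hw1 : w < 1) (B : ℕ) (hB : 0 < B)
    (κ : ℝ) (hκ0 : 0 < κ) (hκ1 : κ < 1) (θ : ℝ) (hθ : 0 < θ) :
    ∃ C : ℝ, 0 < C ∧
      ∀ (p : ℕ) (X : Set (EventTriggered.Vec p))
        (f : Fin n → ℕ → EventTriggered.Vec p → ℝ)
        (g : (i : Fin n) → ℕ → EventTriggered.Vec p → EventTriggered.Vec (m i))
        (G : ℕ → Digraph (Fin n)) (W : ℕ → Matrix (Fin n) (Fin n) ℝ)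
        (s : EventTriggered.Trajectory n p m),
        EventTriggered.ConvexProblem X f g R F₁ F₂ →
        EventTriggered.MixingNetwork G W w B →
        EventTriggered.Generated X f g F₂ W
          (EventTriggered.alphaSeq (EventTriggered.tauSeq θ))
          (EventTriggered.betaSeq κ) (EventTriggered.gammaSeq κ)
          (EventTriggered.tauSeq θ) s →
        ∀ T : ℕ, 1 ≤ T →
          -- network regret against every feasible comparator sequence
          (∀ y ∈ EventTriggered.feasibleSeqs X g T,
            (θ < 1 →
              EventTriggered.netReg f s.x y T ≤
                C * ((T : ℝ) ^ max κ (1 - θ / 2) +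
                  (T : ℝ) ^ (θ / 2) * EventTriggered.pathLength y T)) ∧
            (θ = 1 →
              EventTriggered.netReg f s.x y T ≤
                C * ((T : ℝ) ^ κ + √((T : ℝ) * Real.log T) +
                  √((T : ℝ) / Real.log T) * EventTriggered.pathLength y T)) ∧
            (1 < θ →
              EventTriggered.netReg f s.x y T ≤
                C * ((T : ℝ) ^ max κ (1 / 2) +
                  (T : ℝ) ^ (1 / 2 : ℝ) * EventTriggered.pathLength y T))) ∧
          -- network cumulative constraint violation
          ((EventTriggered.feasibleStatic X g T).Nonempty →
            (θ < 1 →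
              EventTriggered.netCCV g s.x T ≤
                C * (T : ℝ) ^ max (1 - κ / 2) (1 - θ / 4)) ∧
            (θ = 1 →
              EventTriggered.netCCV g s.x T ≤
                C * ((T : ℝ) ^ (1 - κ / 2) +
                  ((T : ℝ) ^ 3 * Real.log T) ^ (1 / 4 : ℝ))) ∧
            (1 < θ →
              EventTriggered.netCCV g s.x T ≤
                C * (T : ℝ) ^ max (1 - κ / 2) (3 / 4))) := by
  obtain ⟨K₁, hK₁, hreg⟩ := exists_regret_bound (F₁ := F₁) hn m hR.le hF₂.le hw0 B hκ0 hκ1 hθ.le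
  obtain ⟨K₂, hK₂, hccv⟩ := exists_violation_bound hn m hR.le hF₁.le hF₂.le hw0 B hκ0 hκ1 hθ.le
  -- One constant for all regimes: `3 ≤ c` serves the logarithmic bound at `θ = 1`, where no pure
  -- power of `T` has the right order.
  obtain ⟨c, hc1, hcle⟩ : ∃ c : ℝ, 3 ≤ c ∧ (θ ≠ 1 → ∀ T : ℕ, 1 ≤ T →
      psiSeq (tauSeq θ) T ≤ c * (T : ℝ) ^ max (1 - θ) 0) := by
    rcases lt_trichotomy θ 1 with h | h | h
    · refine ⟨3 + 1 / (1 - θ), ?_, fun _ T hT => ?_⟩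
      · have : 0 < 1 - θ := sub_pos.2 h
        have : 0 < 1 / (1 - θ) := by positivity
        linarith
      · rw [psiSeq_eq, max_eq_left (by linarith), add_mul, one_div_mul_eq_div]
        have h1 : ∑ t ∈ Finset.range T, tauSeq θ (t + 1) ≤ _ := sum_one_div_rpow_le hθ.le h T
        have h2 : (0 : ℝ) ≤ (T : ℝ) ^ (1 - θ) := by positivity
        linarith
    · exact ⟨3, le_rfl, fun hne => absurd h hne⟩
    · obtain ⟨c, hc, hle⟩ := exists_psiSeq_le h
      refine ⟨3 + c, by linarith, fun _ T _ => ?_⟩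
      rw [max_eq_right (by linarith), Real.rpow_zero, mul_one]
      linarith [hle T]
  have hc1' : 1 ≤ c := by linarith
  -- The factor `2 * c` is the price of merging two powers into one with the larger exponent; the `+
  -- 1` secures positivity.
  refine ⟨2 * c * (K₁ + K₂ + 1), by positivity, ?_⟩
  intro p X f g G W s hP hW h T hT
  have hT1 : (1 : ℝ) ≤ T := by exact_mod_cast hT
  have hΨ := one_le_psiSeq (θ := θ) hT
  have hreg' : ∀ y ∈ feasibleSeqs X g T, ∀ b, (T : ℝ) ^ κ + √(T * psiSeq (tauSeq θ) T) +
      √(T / psiSeq (tauSeq θ) T) * pathLength y T ≤ 2 * c * b → 0 ≤ b →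
      netReg f s.x y T ≤ 2 * c * (K₁ + K₂ + 1) * b := by
    intro y hy b hb hb0
    refine (hreg p X f g G W s hP hW h T hT y hy).trans ?_
    have h1 := mul_le_mul_of_nonneg_left hb hK₁
    have h2 : 0 ≤ 2 * c * (K₂ + 1) * b := by positivity
    linarith
  have hccv' : (feasibleStatic X g T).Nonempty → ∀ b, (T : ℝ) ^ (1 - κ / 2) +
      ((T : ℝ) ^ 3 * psiSeq (tauSeq θ) T) ^ (1 / 4 : ℝ) ≤ 2 * c * b → 0 ≤ b →
      netCCV g s.x T ≤ 2 * c * (K₁ + K₂ + 1) * b := by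
    intro hy b hb hb0
    refine (hccv p X f g G W s hP hW h T hT hy).trans ?_
    have h1 := mul_le_mul_of_nonneg_left hb hK₂
    have h2 : 0 ≤ 2 * c * (K₁ + 1) * b := by positivity
    linarith
  have hregPow : ∀ y ∈ feasibleSeqs X g T, ∀ e, psiSeq (tauSeq θ) T ≤ c * (T : ℝ) ^ e →
      (T : ℝ) ^ e ≤ psiSeq (tauSeq θ) T → netReg f s.x y T ≤ 2 * c * (K₁ + K₂ + 1) *
        ((T : ℝ) ^ max κ ((1 + e) / 2) + (T : ℝ) ^ ((1 - e) / 2) * pathLength y T) := by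
    intro y hy e he1 he2
    have hPL := pathLength_nonneg y T
    refine hreg' y hy _ ?_ (by positivity)
    have h1 := sqrt_mul_le_rpow hT hc1' he1
    have h2 := mul_le_mul_of_nonneg_right (sqrt_div_le_rpow hT he2) hPL
    have h3 := rpow_add_mul_le_rpow_max hT hc1' κ ((1 + e) / 2)
    have h4 : 0 ≤ (T : ℝ) ^ ((1 - e) / 2) * pathLength y T := by positivity
    have h5 := mul_le_mul_of_nonneg_right hc1' h4
    linarith
  have hccvPow : (feasibleStatic X g T).Nonempty → ∀ e,
      psiSeq (tauSeq θ) T ≤ c * (T : ℝ) ^ e →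
      netCCV g s.x T ≤ 2 * c * (K₁ + K₂ + 1) * (T : ℝ) ^ max (1 - κ / 2) ((3 + e) / 4) := by
    intro hy e he
    refine hccv' hy _ ?_ (by positivity)
    have h1 := rpow_quarter_le_rpow hT hc1' (by linarith) he
    exact (add_le_add_right h1 _).trans (rpow_add_mul_le_rpow_max hT hc1' _ _)
  have hlow := psiSeq_lower hθ.le hT
  refine ⟨fun y hy => ⟨fun hlt => ?_, fun heq => ?_, fun hgt => ?_⟩,
    fun hy => ⟨fun hlt => ?_, fun heq => ?_, fun hgt => ?_⟩⟩
  · have h1 := hcle hlt.ne T hT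
    rw [max_eq_left (by linarith)] at h1
    have h2 := hregPow y hy _ h1 hlow
    rwa [show (1 + (1 - θ)) / 2 = 1 - θ / 2 by ring,
      show (1 - (1 - θ)) / 2 = θ / 2 by ring] at h2
  · have hPL := pathLength_nonneg y T
    refine hreg' y hy _ ?_ (by positivity)
    subst heq
    -- At `T = 1` the logarithm is zero but `Ψ = 1`; the term `T ^ κ = 1` with factor `2 * c` covers
    -- both, and the path length is zero.
    rcases hT.eq_or_lt with rfl | hT2
    · simp [pathLength, psiSeq, tauSeq]
      linarith
    · have hlog : 0 < Real.log T := Real.log_pos (by exact_mod_cast hT2)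
      have h1 : √(T * psiSeq (tauSeq 1) T) ≤ 2 * c * √(T * Real.log T) := by
        refine Real.sqrt_le_iff.2 ⟨by positivity, ?_⟩
        rw [mul_pow, Real.sq_sqrt (by positivity)]
        calc T * psiSeq (tauSeq 1) T ≤ T * (3 * Real.log T) := by
              gcongr; exact psiSeq_one_le_log hT2
          _ = 3 * (T * Real.log T) := by ring
          _ ≤ _ := by gcongr; nlinarith
      have h2 : √(T / psiSeq (tauSeq 1) T) ≤ √(T / Real.log T) := by
        gcongr; exact log_le_psiSeq_one hT
      have h3 := mul_le_mul_of_nonneg_right h2 hPL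
      have h4 : 0 ≤ √(T / Real.log T) * pathLength y T := by positivity
      have h5 : (0 : ℝ) ≤ (T : ℝ) ^ κ := by positivity
      have h6 := mul_le_mul_of_nonneg_right (show 1 ≤ 2 * c by linarith) h4
      have h7 := mul_le_mul_of_nonneg_right (show 1 ≤ 2 * c by linarith) h5
      linarith
  · have h1 := hcle hgt.ne' T hT
    rw [max_eq_right (by linarith)] at h1
    -- For `θ > 1` the exponent is `0`: `Ψ` lies between `1` and `c`.
    have h2 := hregPow y hy _ h1 (by simpa using hΨ)
    rwa [add_zero, sub_zero] at h2
  · have h1 := hcle hlt.ne T hT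
    rw [max_eq_left (by linarith)] at h1
    have h2 := hccvPow hy _ h1
    rwa [show (3 + (1 - θ)) / 4 = 1 - θ / 4 by ring] at h2
  · have hlog0 : 0 ≤ Real.log T := Real.log_nonneg hT1
    refine hccv' hy _ ?_ (by positivity)
    subst heq
    rcases hT.eq_or_lt with rfl | hT2
    · simp [psiSeq, tauSeq]
      linarith
    · have h1 : ((T : ℝ) ^ 3 * psiSeq (tauSeq 1) T) ^ (1 / 4 : ℝ) ≤
          c * ((T : ℝ) ^ 3 * Real.log T) ^ (1 / 4 : ℝ) := by
        calc _ ≤ ((c : ℝ) * ((T : ℝ) ^ 3 * Real.log T)) ^ (1 / 4 : ℝ) := by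
              refine Real.rpow_le_rpow (by positivity) ?_ (by norm_num)
              have h2 := psiSeq_one_le_log hT2
              calc (T : ℝ) ^ 3 * psiSeq (tauSeq 1) T ≤ (T : ℝ) ^ 3 * (c * Real.log T) := by
                    gcongr
                    exact h2.trans (by gcongr)
                _ = _ := by ring
          _ = c ^ (1 / 4 : ℝ) * ((T : ℝ) ^ 3 * Real.log T) ^ (1 / 4 : ℝ) :=
              Real.mul_rpow (by positivity) (by positivity)
          _ ≤ _ := by
              gcongr
              simpa using Real.rpow_le_rpow_of_exponent_le hc1' (show (1 / 4 : ℝ) ≤ 1 by norm_num)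
      have h5 : (0 : ℝ) ≤ (T : ℝ) ^ (1 - κ / 2) := by positivity
      have h6 : 0 ≤ c * ((T : ℝ) ^ 3 * Real.log T) ^ (1 / 4 : ℝ) := by positivity
      have h7 := mul_le_mul_of_nonneg_right (show 1 ≤ 2 * c by linarith) h5
      linarith
  · have h1 := hcle hgt.ne' T hT
    rw [max_eq_right (by linarith)] at h1
    have h2 := hccvPow hy _ h1
    rwa [add_zero] at h2
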